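/- Let $k$ be a field. A bound quiver $(Q,I)$ is a quiver $Q$ with a two-sided ideal $I$ of the path algebra $kQ$ such that $F^m\subseteq I\subseteq F^2$ for some $m\ge 2$, where $F$ is the ideal generated by the arrows; $kQ(x,y)$ is the span of the paths from $x$ to $y$ and $I(x,y)=I\cap kQ(x,y)$. A nonzero $\rho=\sum_{i=1}^r\lambda_iw_i\in I(x,y)$ ($\lambda_i\in k^*$, $w_i$ distinct paths) is *indecomposable* if no nonempty proper partial sum lies in $I$; it is a *minimal relation* if moreover $r\ge 2$ (for $r=1$ it is a multiple of a path in $I$). *Natural homotopy* $\sim_\circ$ is the smallest equivalence relation on paths that is stable under composition with paths on both sides and identifies any two paths appearing in the same minimal relation; $\tilde\sigma$ is the class of $\sigma$. The *classifying space* $\mathcal B(Q,I)$ is the CW-complex whose $0$-cells are the vertices of $Q$ and whose $n$-cells, $n\ge1$, are the tuples $(\tilde\sigma_1,\dots,\tilde\sigma_n)$ of classes having representatives $\sigma_i$ that are non-stationary paths, composable, with $\sigma_1\cdots\sigma_n\notin I$. The cell is a standard $n$-simplex, with vertices ordered along the path; its face opposite to the vertex $0$, resp. $n$, is glued to $(\tilde\sigma_2,\dots,\tilde\sigma_n)$,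 resp. $(\tilde\sigma_1,\dots,\tilde\sigma_{n-1})$ (for $n=1$: to the target, resp. the source, of $\sigma_1$), and the face opposite to the vertex $i$, $0<i<n$, to $(\tilde\sigma_1,\dots,\widetilde{\sigma_i\sigma_{i+1}},\dots,\tilde\sigma_n)$. A *covering morphism* $p:(\hat Q,\hat I)\to(Q,I)$ is a morphism of quivers with $p(\hat I)\subseteq I$ that is surjective on vertices, induces bijections from the arrows leaving (resp. entering) each vertex $\hat x$ to those leaving (resp. entering) $p(\hat x)$, and is such that for every indecomposable $\rho\in I(x,y)$ and every $\hat x\in p^{-1}(x)$ there are $\hat y\in p^{-1}(y)$ and $\hat\rho\in\hat I(\hat x,\hat y)$ with $p(\hat\rho)=\rho$. It induces $\mathcal Bp:\mathcal B(\hat Q,\hat I)\to\mathcal B(Q,I)$, which maps the simplex of $(\tilde\sigma_1,\dots,\tilde\sigma_n)$ identically to that of $(\widetilde{p\sigma_1},\dots,\widetilde{p\sigma_n})$. A *cover* of $(Q,I)$ is a covering morphism from a bound quiver $(\hat Q,\hat I)$ with $\hat Q$ connected (and possibly infinite). It is a *universal cover* if for every cover $p':(\bar Q,\bar I)\to(Q,I)$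 there is a covering morphism $\pi:(\hat Q,\hat I)\to(\bar Q,\bar I)$ with $p=p'\pi$. **Corollary 4.4.** Let $(Q,I)$ be a bound quiver with $Q$ finite and connected (in particular nonempty), and let $p:(\hat Q,\hat I)\to(Q,I)$ be a universal cover. Then $\mathcal Bp:\mathcal B(\hat Q,\hat I)\to\mathcal B(Q,I)$ is the universal covering space of $\mathcal B(Q,I)$: it is a surjective covering map and $\mathcal B(\hat Q,\hat I)$ is simply connected (in particular arcwise connected). -/

import Mathlib

open CategoryTheory

universe u v w

namespace BoundQuiver

section Ideals

variable {k : Type w} [Field k] {V : Type u} [Quiver.{v} V]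

/-- A two-sided ideal of the path algebra `kV`, in the language of the `k`-linear path category
(where the algebra is regarded as the category with the vertices as objects): a family of subspaces
`I(x, y)` of the spaces `kV(x, y)` of formal linear combinations of paths from `x` to `y`,
stable under composition with paths on both sides.  Paths are composed from left to right. -/
structure PathIdeal (k : Type w) [Field k] (V : Type u) [Quiver.{v} V] where
  /-- The subspace `I(x, y)` of `kV(x, y)`. -/
  carrier : ∀ x y : V, Submodule k (Quiver.Path x y →₀ k)
  comp_left_mem : ∀ {x y z : V} (a : Quiver.Path x y) {ρ : Quiver.Path y z →₀ k},
    ρ ∈ carrier y z → ρ.mapDomain (fun b => a.comp b) ∈ carrier x z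
  comp_right_mem : ∀ {x y z : V} {ρ : Quiver.Path x y →₀ k} (b : Quiver.Path y z),
    ρ ∈ carrier x y → ρ.mapDomain (fun a => a.comp b) ∈ carrier x z

/-- The partial sum of `ρ` over the terms whose path belongs to `S`. -/
noncomputable def partialSum {x y : V} (ρ : Quiver.Path x y →₀ k) (S : Set (Quiver.Path x y)) :
    Quiver.Path x y →₀ k :=
  open Classical in ρ.filter (fun a => a ∈ S)

/-- A path is zero in the bound quiver when it lies in the ideal. -/
def PathIdeal.IsZeroPath (I : PathIdeal k V) {x y : V} (a : Quiver.Path x y) : Prop :=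
  Finsupp.single a (1 : k) ∈ I.carrier x y

/-- The ideal `F ^ m`, where `F` is generated by the arrows: its part from `x` to `y` is spanned by
the paths of length at least `m`. -/
noncomputable def arrowIdealPow (k : Type w) [Field k] {V : Type u} [Quiver.{v} V] (m : ℕ) (x y : V) :
    Submodule k (Quiver.Path x y →₀ k) :=
  Submodule.span k {ρ | ∃ a : Quiver.Path x y, m ≤ a.length ∧ ρ = Finsupp.single a 1}

/-- Admissible ideals: `F ^ m ⊆ I ⊆ F ^ 2` for some `m ≥ 2`. -/
def PathIdeal.IsAdmissible (I : PathIdeal k V) : Prop :=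
  ∃ m : ℕ, 2 ≤ m ∧ ∀ x y : V,
    arrowIdealPow k m x y ≤ I.carrier x y ∧ I.carrier x y ≤ arrowIdealPow k 2 x y

/-- A nonzero element `ρ = ∑ i, λ i • w i` of `I(x, y)` (the `λ i` nonzero, the `w i` distinct
paths), no nonempty proper partial sum of which lies in `I`.  It has either a single term, and then
it is a multiple of a zero path, or at least two terms. -/
structure PathIdeal.IsIndecomposableRelation (I : PathIdeal k V) {x y : V}
    (ρ : Quiver.Path x y →₀ k) : Prop where
  mem : ρ ∈ I.carrier x y
  ne_zero : ρ ≠ 0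
  partial_sum : ∀ S : Set (Quiver.Path x y), partialSum ρ S ∈ I.carrier x y →
    partialSum ρ S = 0 ∨ partialSum ρ S = ρ

/-- Minimal relations: those with at least two terms. -/
def PathIdeal.IsMinimalRelation (I : PathIdeal k V) {x y : V} (ρ : Quiver.Path x y →₀ k) : Prop :=
  I.IsIndecomposableRelation ρ ∧ 2 ≤ ρ.support.card

/-- Two parallel paths appear in the same minimal relation. -/
def PathIdeal.minimalRel (I : PathIdeal k V) : HomRel (Paths V) :=
  fun (x y : V) (a b : Quiver.Path x y) =>
    ∃ ρ : Quiver.Path x y →₀ k, I.IsMinimalRelation ρ ∧ a ∈ ρ.support ∧ b ∈ ρ.support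

/-- The path category modulo natural homotopy, that is, modulo the smallest equivalence relation
that contains `minimalRel` and is stable under composition with paths. -/
abbrev PathIdeal.HomotopyCat (I : PathIdeal k V) : Type u := CategoryTheory.Quotient I.minimalRel

/-- A path is sent to its natural homotopy class. -/
abbrev PathIdeal.toHomotopyCat (I : PathIdeal k V) : Paths V ⥤ I.HomotopyCat :=
  CategoryTheory.Quotient.functor I.minimalRel

end Ideals

/-- A quiver is connected when it is nonempty and any two vertices are joined by a walk. -/
def IsConnectedQuiver (V : Type u) [Quiver.{v} V] : Prop :=
  Nonempty V ∧ ∀ x y : Quiver.Symmetrify V, Nonempty (Quiver.Path x y)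

/-! ### Realization of a sequence of cells with face maps -/

section Realization

/-- The points of the disjoint union of one standard `n`-simplex for each `n`-cell. -/
abbrev SimplexSum (X : ℕ → Type u) : Type u :=
  Σ c : (Σ n, X n), stdSimplex ℝ (Fin (c.1 + 1))

/-- For an `(n+1)`-cell `c`, the `i`-th face of its simplex (the face `t i = 0`) is glued to the
simplex of the `i`-th face `d i c`, preserving the order of the vertices. -/
inductive FaceRel (X : ℕ → Type u) (d : ∀ n, Fin (n + 2) → X (n + 1) → X n) :
    SimplexSum X → SimplexSum X → Prop
  | glue (n : ℕ) (i : Fin (n + 2)) (c : X (n + 1)) (t : stdSimplex ℝ (Fin (n + 1))) :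
    FaceRel X d ⟨⟨n, d n i c⟩, t⟩ ⟨⟨n + 1, c⟩, stdSimplex.map i.succAbove t⟩

/-- The CW-complex with one `n`-cell for each element of `X n`, attached along its faces, with the
quotient topology of the disjoint union of the simplices. -/
def Realization (X : ℕ → Type u) (d : ∀ n, Fin (n + 2) → X (n + 1) → X n) : Type u :=
  Quot (FaceRel X d)

instance (X : ℕ → Type u) (d : ∀ n, Fin (n + 2) → X (n + 1) → X n) :
    TopologicalSpace (Realization X d) :=
  inferInstanceAs (TopologicalSpace (Quot (FaceRel X d)))

/-- The map of realizations that sends the simplex of a cell `c` identically to the simplex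
of the cell `f c`. -/
def Realization.map {X Y : ℕ → Type u} {d : ∀ n, Fin (n + 2) → X (n + 1) → X n}
    {e : ∀ n, Fin (n + 2) → Y (n + 1) → Y n} (f : ∀ n, X n → Y n)
    (hf : ∀ n i c, f n (d n i c) = e n i (f (n + 1) c)) : Realization X d → Realization Y e :=
  Quot.map (fun z => ⟨⟨z.1.1, f z.1.1 z.1.2⟩, z.2⟩) (by
    rintro _ _ ⟨n, i, c, t⟩
    dsimp only
    rw [hf]
    exact FaceRel.glue n i (f (n + 1) c) t)

end Realization

/-! ### The classifying space -/

section ClassifyingSpace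

variable {k : Type w} [Field k] {V : Type u} [Quiver.{u} V]

/-- A sequence `x₀ ⟶ x₁ ⟶ ⋯ ⟶ xₙ` of paths `σ₁, …, σₙ` (a functor on `{0 < 1 < ⋯ < n}`) none of
which is stationary and whose composition `σ₁ ⋯ σₙ` is not in `I`. -/
structure PathIdeal.IsNonzeroChain (I : PathIdeal k V) {n : ℕ} (G : Fin (n + 1) ⥤ Paths V) :
    Prop where
  pos : ∀ (i j : Fin (n + 1)) (h : i < j), 0 < Quiver.Path.length (V := V) (G.map (homOfLE h.le))
  nonzero : ¬ I.IsZeroPath (V := V) (G.map (homOfLE (Fin.zero_le (Fin.last n))))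

/-- The set of `n`-cells: the sequences `(σ̃₁, …, σ̃ₙ)` of natural homotopy classes that admit
representatives forming a nonzero chain.  For `n = 0` these are the vertices. -/
def PathIdeal.Cell (I : PathIdeal k V) (n : ℕ) : Type u :=
  {F : Fin (n + 1) ⥤ I.HomotopyCat //
    ∃ G : Fin (n + 1) ⥤ Paths V, I.IsNonzeroChain G ∧ G ⋙ I.toHomotopyCat = F}

/-- The inclusion of `{0 < ⋯ < n}` in `{0 < ⋯ < n + 1}` that omits `i`. -/
abbrev faceInclusion {n : ℕ} (i : Fin (n + 2)) : Fin (n + 1) ⥤ Fin (n + 2) :=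
  (Fin.strictMono_succAbove i).monotone.functor

theorem PathIdeal.IsZeroPath.comp {I : PathIdeal k V} {a b c d : V} (f : Quiver.Path a b)
    {g : Quiver.Path b c} (h : Quiver.Path c d) (hg : I.IsZeroPath g) :
    I.IsZeroPath ((f.comp g).comp h) := by
  have h1 := I.comp_right_mem h (I.comp_left_mem f hg)
  simpa [PathIdeal.IsZeroPath, Finsupp.mapDomain_single] using h1

theorem PathIdeal.IsNonzeroChain.face {I : PathIdeal k V} {n : ℕ}
    {G : Fin (n + 1 + 1) ⥤ Paths V} (hG : I.IsNonzeroChain G) (i : Fin (n + 2)) :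
    I.IsNonzeroChain (faceInclusion i ⋙ G) := by
  refine ⟨fun a b h => hG.pos _ _ (Fin.strictMono_succAbove i h), fun hz => hG.nonzero ?_⟩
  have e : (homOfLE (Fin.zero_le (Fin.last (n + 1))) : (0 : Fin (n + 2)) ⟶ Fin.last (n + 1)) =
      (homOfLE (Fin.zero_le (i.succAbove 0)) ≫
        (faceInclusion i).map (homOfLE (Fin.zero_le (Fin.last n)))) ≫
        homOfLE (Fin.le_last (i.succAbove (Fin.last n))) := Subsingleton.elim _ _
  have e' : G.map (homOfLE (Fin.zero_le (Fin.last (n + 1)))) = _ :=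
    (congrArg (fun f => G.map f) e).trans
      ((G.map_comp _ _).trans (congrArg (fun f => f ≫ _) (G.map_comp _ _)))
  rw [e']
  exact PathIdeal.IsZeroPath.comp (V := V) _ _ hz

/-- The `i`-th face of a cell: it deletes the vertex `xᵢ`, so it drops `σ̃₁` if `i = 0`, drops the
last class if `i` is the last index, and otherwise composes the two classes that meet at `xᵢ`. -/
def PathIdeal.face (I : PathIdeal k V) (n : ℕ) (i : Fin (n + 2)) (c : I.Cell (n + 1)) :
    I.Cell n :=
  ⟨faceInclusion i ⋙ c.1, by
    obtain ⟨G, hG, hc⟩ := c.2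
    exact ⟨faceInclusion i ⋙ G, hG.face i, by rw [← hc]; rfl⟩⟩

/-- The classifying space of the quiver `V` bound by the ideal `I`. -/
abbrev ClassifyingSpace (I : PathIdeal k V) : Type u := Realization I.Cell I.face

end ClassifyingSpace

/-! ### Coverings of bound quivers -/

section Coverings

variable {k : Type w} [Field k] {W V : Type u} [Quiver.{u} W] [Quiver.{u} V]

/-- The linear map `kW(x, y) → kV(p x, p y)` induced by a morphism `p` of quivers. -/
noncomputable def pushforward (p : W ⥤q V) {x y : W} (ρ : Quiver.Path x y →₀ k) :
    Quiver.Path (p.obj x) (p.obj y) →₀ k :=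
  ρ.mapDomain p.mapPath

/-- Covering morphisms of bound quivers `(W, J) → (V, I)`. -/
structure IsCoveringMorphism (J : PathIdeal k W) (I : PathIdeal k V) (p : W ⥤q V) : Prop where
  /-- `p` is a morphism of bound quivers. -/
  map_mem : ∀ {x y : W} (ρ : Quiver.Path x y →₀ k),
    ρ ∈ J.carrier x y → pushforward p ρ ∈ I.carrier (p.obj x) (p.obj y)
  /-- `p` is surjective on vertices. -/
  surjective : Function.Surjective p.obj
  /-- `p` is bijective on the arrows leaving, and on those entering, each vertex. -/
  covering : p.IsCovering
  /-- Each relation (a zero path or a minimal relation, up to scalars) lifts to a relation with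
  any prescribed starting point over its own starting point. -/
  lift : ∀ (x : W) (y : V) (ρ : Quiver.Path (p.obj x) y →₀ k), I.IsIndecomposableRelation ρ →
    ∃ (y' : W) (hy : p.obj y' = y) (ρ' : Quiver.Path x y' →₀ k),
      ρ' ∈ J.carrier x y' ∧ hy ▸ pushforward p ρ' = ρ

/-- A cover of `(V, I)`: a covering morphism from a connected bound quiver. -/
structure IsCover (J : PathIdeal k W) (I : PathIdeal k V) (p : W ⥤q V) : Prop where
  admissible : J.IsAdmissible
  connected : IsConnectedQuiver W
  isCoveringMorphism : IsCoveringMorphism J I p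

/-- The universal cover of a bound quiver: a cover that factors through every cover by a covering
morphism. -/
structure IsUniversalCover (J : PathIdeal k W) (I : PathIdeal k V) (p : W ⥤q V) : Prop where
  isCover : IsCover J I p
  universal : ∀ (U : Type u) [Quiver.{u} U] (K : PathIdeal k U) (q : U ⥤q V), IsCover K I q →
    ∃ π : W ⥤q U, IsCoveringMorphism J K π ∧ π ⋙q q = p

/-- The functor between path categories induced by a morphism of quivers. -/
def pathFunctor (p : W ⥤q V) : Paths W ⥤ Paths V where
  obj x := p.obj x
  map {x y} a := p.mapPath (show Quiver.Path (V := W) x y from a)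
  map_id _ := rfl
  map_comp a b := p.mapPath_comp a b

namespace IsCoveringMorphism

variable {J : PathIdeal k W} {I : PathIdeal k V} {p : W ⥤q V}

theorem mapPath_injective (h : IsCoveringMorphism J I p) (x y : W) :
    Function.Injective (p.mapPath : Quiver.Path x y → Quiver.Path (p.obj x) (p.obj y)) := by
  intro a b hab
  have := Prefunctor.pathStar_injective p (fun u => (h.covering.star_bijective u).1) x
    (a₁ := ⟨y, a⟩) (a₂ := ⟨y, b⟩) (by simp [Prefunctor.pathStar, hab])
  simpa using this

theorem filter_pushforward (h : IsCoveringMorphism J I p) {x y : W} (ρ : Quiver.Path x y →₀ k)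
    (S : Set (Quiver.Path (p.obj x) (p.obj y))) :
    partialSum (pushforward p ρ) S = pushforward p (partialSum ρ (p.mapPath ⁻¹' S)) := by
  classical
  have hinj := h.mapPath_injective x y
  unfold pushforward partialSum
  ext b
  by_cases hb : b ∈ Set.range (p.mapPath : Quiver.Path x y → _)
  · obtain ⟨a, rfl⟩ := hb
    rw [Finsupp.filter_apply, Finsupp.mapDomain_apply hinj, Finsupp.mapDomain_apply hinj,
      Finsupp.filter_apply]
    rfl
  · rw [Finsupp.filter_apply, Finsupp.mapDomain_of_notMem_range _ _ hb,
      Finsupp.mapDomain_of_notMem_range _ _ hb, ite_self]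

theorem mem_of_indecomposable (h : IsCoveringMorphism J I p) {x y : W}
    {ρ : Quiver.Path x y →₀ k} (hρ : I.IsIndecomposableRelation (pushforward p ρ)) :
    ρ ∈ J.carrier x y := by
  classical
  obtain ⟨y', hy, ρ', hρ', e⟩ := h.lift x _ _ hρ
  have hinj := Prefunctor.pathStar_injective p (fun u => (h.covering.star_bijective u).1) x
  have key : ∀ (z : V) (hz : p.obj y' = z) (σ : Quiver.Path (p.obj x) z →₀ k),
      hz ▸ pushforward p ρ' = σ → ∀ b ∈ σ.support, ∃ a : Quiver.Path x y',
        (⟨p.obj y', p.mapPath a⟩ : Quiver.PathStar (p.obj x)) = ⟨z, b⟩ := by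
    rintro _ rfl σ rfl b hb
    obtain ⟨a, -, ha⟩ := Finset.mem_image.1 (Finsupp.mapDomain_support hb)
    exact ⟨a, by rw [ha]⟩
  obtain ⟨b, hb⟩ := Finsupp.support_nonempty_iff.2 hρ.ne_zero
  obtain ⟨a, ha⟩ := key _ hy _ e b hb
  obtain ⟨c, -, hc⟩ := Finset.mem_image.1 (Finsupp.mapDomain_support hb)
  have hac : (⟨y', a⟩ : Quiver.PathStar x) = ⟨y, c⟩ := hinj (by
    change (⟨p.obj y', p.mapPath a⟩ : Quiver.PathStar (p.obj x)) = ⟨p.obj y, p.mapPath c⟩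
    rw [ha, hc])
  obtain rfl : y' = y := congrArg Sigma.fst hac
  have : ρ' = ρ := Finsupp.mapDomain_injective (h.mapPath_injective x y') e
  exact this ▸ hρ'

theorem mem_of_pushforward_mem (h : IsCoveringMorphism J I p) {x y : W} :
    ∀ (n : ℕ) (ρ : Quiver.Path x y →₀ k), ρ.support.card ≤ n →
      pushforward p ρ ∈ I.carrier (p.obj x) (p.obj y) → ρ ∈ J.carrier x y := by
  classical
  have hinj := Finsupp.mapDomain_injective (M := k) (h.mapPath_injective x y)
  intro n
  induction n with
  | zero =>
    intro ρ hn _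
    have : ρ = 0 := by simpa using hn
    exact this ▸ zero_mem _
  | succ n ih =>
    intro ρ hn hρ
    by_cases hind : I.IsIndecomposableRelation (pushforward p ρ)
    · exact h.mem_of_indecomposable hind
    by_cases h0 : ρ = 0
    · exact h0 ▸ zero_mem _
    have hne : pushforward p ρ ≠ 0 := fun h1 => h0 (hinj (by
      simpa [pushforward] using h1))
    have : ∃ S : Set (Quiver.Path (p.obj x) (p.obj y)),
        partialSum (pushforward p ρ) S ∈ I.carrier (p.obj x) (p.obj y) ∧
        partialSum (pushforward p ρ) S ≠ 0 ∧
        partialSum (pushforward p ρ) S ≠ pushforward p ρ := by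
      by_contra hcon
      push Not at hcon
      exact hind ⟨hρ, hne, fun S hS => or_iff_not_imp_left.2 (hcon S hS)⟩
    obtain ⟨S, hS, hS0, hS1⟩ := this
    rw [h.filter_pushforward] at hS hS0 hS1
    set T : Set (Quiver.Path x y) := p.mapPath ⁻¹' S
    have hsum : partialSum ρ T + partialSum ρ Tᶜ = ρ := by
      unfold partialSum
      ext a
      by_cases ha : a ∈ T <;> simp [ha]
    have hcard : (partialSum ρ T).support.card +
        (partialSum ρ Tᶜ).support.card = ρ.support.card := by
      have e1 : (partialSum ρ T).support = ρ.support.filter (fun a => a ∈ T) := by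
        ext a
        by_cases ha : a ∈ T <;> simp [partialSum, ha]
      have e2 : (partialSum ρ Tᶜ).support = ρ.support.filter (fun a => ¬ a ∈ T) := by
        ext a
        by_cases ha : a ∈ T <;> simp [partialSum, ha]
      rw [e1, e2]
      exact Finset.card_filter_add_card_filter_not _
    have c1 : (partialSum ρ T).support.card ≠ 0 := by
      intro hz
      apply hS0
      have : partialSum ρ T = 0 := by simpa using hz
      rw [this]
      simp [pushforward]
    have c2 : (partialSum ρ Tᶜ).support.card ≠ 0 := by
      intro hz
      apply hS1
      have : partialSum ρ Tᶜ = 0 := by simpa using hz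
      rw [this, add_zero] at hsum
      rw [hsum]
    have hpush : pushforward p (partialSum ρ Tᶜ) =
        pushforward p ρ - pushforward p (partialSum ρ T) := by
      rw [eq_sub_iff_add_eq, add_comm]
      simp only [pushforward]
      rw [← Finsupp.mapDomain_add, hsum]
    rw [← hsum]
    refine add_mem (ih _ (by omega) hS) (ih _ (by omega) ?_)
    rw [hpush]
    exact sub_mem hρ hS

/-- For a covering morphism, `J(x, y)` is the inverse image of `I(p x, p y)`. -/
theorem mem_iff (h : IsCoveringMorphism J I p) {x y : W} (ρ : Quiver.Path x y →₀ k) :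
    pushforward p ρ ∈ I.carrier (p.obj x) (p.obj y) ↔ ρ ∈ J.carrier x y :=
  ⟨h.mem_of_pushforward_mem _ ρ le_rfl, h.map_mem ρ⟩

theorem isZeroPath_iff (h : IsCoveringMorphism J I p) {x y : W} (a : Quiver.Path x y) :
    I.IsZeroPath (p.mapPath a) ↔ J.IsZeroPath a := by
  have := h.mem_iff (Finsupp.single a (1 : k))
  rwa [pushforward, Finsupp.mapDomain_single] at this

theorem isMinimalRelation (h : IsCoveringMorphism J I p) {x y : W} {ρ : Quiver.Path x y →₀ k}
    (hρ : J.IsMinimalRelation ρ) : I.IsMinimalRelation (pushforward p ρ) := by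
  classical
  have hinj := Finsupp.mapDomain_injective (M := k) (h.mapPath_injective x y)
  refine ⟨⟨h.map_mem ρ hρ.1.mem, fun h0 => hρ.1.ne_zero (hinj ?_), fun S hS => ?_⟩, ?_⟩
  · simpa [pushforward] using h0
  · rw [h.filter_pushforward] at hS ⊢
    rw [h.mem_iff] at hS
    rcases hρ.1.partial_sum _ hS with h1 | h1
    · left
      rw [h1]
      simp [pushforward]
    · right
      rw [h1]
  · rw [pushforward, Finsupp.mapDomain_support_of_injective (h.mapPath_injective x y),
      Finset.card_image_of_injective _ (h.mapPath_injective x y)]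
    exact hρ.2

/-- A covering morphism respects natural homotopy. -/
def homotopyFunctor (h : IsCoveringMorphism J I p) : J.HomotopyCat ⥤ I.HomotopyCat :=
  CategoryTheory.Quotient.lift J.minimalRel (pathFunctor p ⋙ I.toHomotopyCat) (by
    rintro (x : W) (y : W) (a : Quiver.Path x y) (b : Quiver.Path x y) ⟨ρ, hρ, ha, hb⟩
    refine CategoryTheory.Quotient.sound I.minimalRel
      ⟨pushforward p ρ, h.isMinimalRelation hρ, ?_, ?_⟩
    · refine Finsupp.mem_support_iff.2 ?_
      exact ne_of_eq_of_ne (Finsupp.mapDomain_apply (h.mapPath_injective x y) ρ a)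
        (Finsupp.mem_support_iff.1 ha)
    · refine Finsupp.mem_support_iff.2 ?_
      exact ne_of_eq_of_ne (Finsupp.mapDomain_apply (h.mapPath_injective x y) ρ b)
        (Finsupp.mem_support_iff.1 hb))

theorem isNonzeroChain (h : IsCoveringMorphism J I p) {n : ℕ} {G : Fin (n + 1) ⥤ Paths W}
    (hG : J.IsNonzeroChain G) : I.IsNonzeroChain (G ⋙ pathFunctor p) := by
  refine ⟨fun i j hij => ?_, fun hz => hG.nonzero ((h.isZeroPath_iff _).1 hz)⟩
  have := hG.pos i j hij
  have e : ∀ {x y : W} (a : Quiver.Path x y), (p.mapPath a).length = a.length := by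
    intro x y a
    induction a with
    | nil => rfl
    | cons a e ih => simp [ih]
  exact lt_of_lt_of_eq this (e _).symm

/-- The cell `(σ̃₁, …, σ̃ₙ)` is sent to the cell of the classes of `p σ₁, …, p σₙ`. -/
def cellMap (h : IsCoveringMorphism J I p) (n : ℕ) (c : J.Cell n) : I.Cell n :=
  ⟨c.1 ⋙ h.homotopyFunctor, by
    obtain ⟨G, hG, hc⟩ := c.2
    exact ⟨G ⋙ pathFunctor p, h.isNonzeroChain hG, by rw [← hc]; rfl⟩⟩

/-- The map of classifying spaces induced by a covering morphism of bound quivers. -/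
def classifyingMap (h : IsCoveringMorphism J I p) : ClassifyingSpace J → ClassifyingSpace I :=
  Realization.map h.cellMap (fun _ _ _ => rfl)

end IsCoveringMorphism

end Coverings

/-- `f : E → X` is a universal covering space of `X`: a covering map, onto, with simply connected
(in particular arcwise connected) total space. -/
structure IsUniversalCoveringSpace {E X : Type*} [TopologicalSpace E] [TopologicalSpace X]
    (f : E → X) : Prop where
  isCoveringMap : IsCoveringMap f
  surjective : Function.Surjective f
  simplyConnected : SimplyConnectedSpace E

end BoundQuiver

/-! ### Simplices, iterated faces and stars in a realization. -/

namespace BoundQuiver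

open unitInterval Topology

/-! ### Faces of the standard simplex -/

section StdSimplex

/-! The map `classifyingMap` is a covering for a combinatorial reason: every cell of the base has
exactly one lift through a given lift of any one of its vertices
(`IsCoveringMorphism.isCellCovering`). Existence comes from lifting paths along the covering of
quivers. Uniqueness comes from lifting natural homotopies, since a minimal relation lifts as a whole
and all its lifted paths share both ends. Unique lifting of cells makes small stars evenly covered
(`IsCellCovering.isCoveringMap`).

Simple connectivity uses the universal property against one particular cover, `FundamentalCover`. A
vertex of it is a vertex `v` of the quiver together with a homotopy class of paths in the
classifying space from a base point to `v`; an arrow multiplies the class by its edge. This is a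
cover because paths in one minimal relation are homotopic in the classifying space
(`edgePath_eq_of_isMinimalRelation`): they define the same 1-cell, and 2-cells break that edge into
arrows.

Let the universal cover factor through it by `π`. For an arrow `x ⟶ y` upstairs, a chosen class from
`x₀` to `x` extended by the arrow, and the class chosen for `y`, have the same image downstairs,
because `π` records that image. A covering map is injective on homotopy classes, so the two agree
upstairs. Classes to the vertices that are compatible with all edges force simple connectivity
(`FaceAction.simplyConnectedSpace`): they extend over simplices to all points, compatibly with every
path. -/

theorem stdSimplex_map_apply {α β : Type*} [Fintype α] [Fintype β] {f : α → β}
    (hf : Function.Injective f) (t : stdSimplex ℝ α) (a : α) : stdSimplex.map f t (f a) = t a := by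
  classical
  rw [stdSimplex.map_coe, FunOnFinite.linearMap_apply_apply, Finset.sum_eq_single a]
  · intro b hb hba
    exact absurd (hf (by simpa using hb)) hba
  · simp

theorem stdSimplex_map_apply_of_notMem_range {α β : Type*} [Fintype α] [Fintype β] {f : α → β}
    (t : stdSimplex ℝ α) {b : β} (hb : b ∉ Set.range f) : stdSimplex.map f t b = 0 := by
  classical
  rw [stdSimplex.map_coe, FunOnFinite.linearMap_apply_apply, Finset.sum_eq_zero]
  intro a ha
  exact absurd ⟨a, by simpa using ha⟩ hb

/-- A point of the simplex with vanishing `i`-th coordinate is in the `i`-th face. -/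
theorem exists_stdSimplex_map_succAbove {n : ℕ} (i : Fin (n + 2)) (t : stdSimplex ℝ (Fin (n + 2)))
    (hi : t i = 0) : ∃ s : stdSimplex ℝ (Fin (n + 1)), stdSimplex.map i.succAbove s = t := by
  refine ⟨⟨fun j => t (i.succAbove j), fun j => t.2.1 _, ?_⟩, ?_⟩
  · have := stdSimplex.sum_eq_one t
    rwa [Fin.sum_univ_succAbove _ i, hi, zero_add] at this
  · ext j
    rcases Fin.eq_self_or_eq_succAbove i j with rfl | ⟨k, rfl⟩
    · rw [stdSimplex_map_apply_of_notMem_range _ (by simp), hi]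
    · rw [stdSimplex_map_apply Fin.succAbove_right_injective]
      rfl

/-- The point dividing a segment in the standard simplex in a given ratio. -/
def simplexSegment {n : ℕ} (p : I × stdSimplex ℝ (Fin (n + 1)) × stdSimplex ℝ (Fin (n + 1))) :
    stdSimplex ℝ (Fin (n + 1)) :=
  ⟨(1 - (p.1 : ℝ)) • (p.2.1 : Fin (n + 1) → ℝ) + (p.1 : ℝ) • (p.2.2 : Fin (n + 1) → ℝ),
    convex_stdSimplex ℝ _ p.2.1.2 p.2.2.2 (sub_nonneg.2 p.1.2.2) p.1.2.1 (by ring)⟩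

theorem continuous_simplexSegment {n : ℕ} :
    Continuous (simplexSegment (n := n)) := by
  unfold simplexSegment
  fun_prop

@[simp]
theorem simplexSegment_zero {n : ℕ} (s t : stdSimplex ℝ (Fin (n + 1))) :
    simplexSegment (0, s, t) = s := by
  ext j
  change (1 - ((0 : I) : ℝ)) * s j + ((0 : I) : ℝ) * t j = s j
  simp

@[simp]
theorem simplexSegment_one {n : ℕ} (s t : stdSimplex ℝ (Fin (n + 1))) :
    simplexSegment (1, s, t) = t := by
  ext j
  change (1 - ((1 : I) : ℝ)) * s j + ((1 : I) : ℝ) * t j = t j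
  simp

@[simp]
theorem simplexSegment_self {n : ℕ} (r : I) (s : stdSimplex ℝ (Fin (n + 1))) :
    simplexSegment (r, s, s) = s := by
  ext j
  change (1 - (r : ℝ)) * s j + (r : ℝ) * s j = s j
  ring

theorem map_simplexSegment {m n : ℕ} (f : Fin (m + 1) → Fin (n + 1)) (r : I)
    (s t : stdSimplex ℝ (Fin (m + 1))) : stdSimplex.map f (simplexSegment (r, s, t)) =
      simplexSegment (r, stdSimplex.map f s, stdSimplex.map f t) := by
  ext j
  change FunOnFinite.linearMap ℝ ℝ f ((1 - (r : ℝ)) • (s : Fin (m + 1) → ℝ) + (r : ℝ) •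
      (t : Fin (m + 1) → ℝ)) j = (1 - (r : ℝ)) * FunOnFinite.linearMap ℝ ℝ f s j +
        (r : ℝ) * FunOnFinite.linearMap ℝ ℝ f t j
  rw [map_add, map_smul, map_smul]
  rfl

instance simplyConnectedSpace_stdSimplex (n : ℕ) :
    SimplyConnectedSpace (stdSimplex ℝ (Fin (n + 1))) :=
  have : ContractibleSpace (stdSimplex ℝ (Fin (n + 1))) :=
    (convex_stdSimplex ℝ _).contractibleSpace
      ⟨_, (stdSimplex.vertex (S := ℝ) (0 : Fin (n + 1))).2⟩
  inferInstance

/-- Supplies the threshold of a star around an interior point: half of the smallest coordinate lies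
below all of them. -/
theorem exists_lt_forall_coord {n : ℕ} (t : Fin (n + 1) → ℝ) (ht : ∀ i, 0 < t i) :
    ∃ δ : ℝ, 0 < δ ∧ ∀ i, δ < t i := by
  obtain ⟨i, -, hi⟩ := Finset.exists_min_image Finset.univ t ⟨0, Finset.mem_univ _⟩
  exact ⟨t i / 2, half_pos (ht i), fun j => (half_lt_self (ht i)).trans_le (hi j (Finset.mem_univ _))⟩

end StdSimplex

/-! ### Iterated faces -/

/-- The action of the injective increasing maps on the cells which extends the face maps. -/
structure FaceAction (X : ℕ → Type u) (d : ∀ n, Fin (n + 2) → X (n + 1) → X n) where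
  res : ∀ {m n : ℕ}, (Fin (m + 1) ↪o Fin (n + 1)) → X n → X m
  res_refl : ∀ {n : ℕ} (c : X n), res (RelEmbedding.refl _) c = c
  res_res : ∀ {l m n : ℕ} (f : Fin (l + 1) ↪o Fin (m + 1)) (g : Fin (m + 1) ↪o Fin (n + 1))
    (c : X n), res f (res g c) = res (f.trans g) c
  res_succAbove : ∀ {n : ℕ} (i : Fin (n + 2)) (c : X (n + 1)), res i.succAboveOrderEmb c = d n i c

theorem orderEmb_eq_refl {n : ℕ} (f : Fin (n + 1) ↪o Fin (n + 1)) : f = RelEmbedding.refl _ := by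
  refine DFunLike.coe_injective ((f.strictMono.range_inj strictMono_id).1 ?_)
  rw [Set.range_id, Set.range_eq_univ]
  exact Finite.surjective_of_injective f.injective

/-- An order embedding whose range avoids `i` factors through `i.succAbove`. -/
theorem exists_orderEmb_trans_succAbove {m n : ℕ} (f : Fin (m + 1) ↪o Fin (n + 2)) (i : Fin (n + 2))
    (hi : i ∉ Set.range f) :
    ∃ g : Fin (m + 1) ↪o Fin (n + 1), f = g.trans i.succAboveOrderEmb := by
  have h : ∀ j, ∃ k, i.succAbove k = f j := fun j =>
    Fin.exists_succAbove_eq fun e => hi ⟨j, e⟩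
  choose g hg using h
  refine ⟨OrderEmbedding.ofStrictMono g fun a b hab => ?_, ?_⟩
  · rw [← (Fin.strictMono_succAbove i).lt_iff_lt, hg, hg]
    exact f.strictMono hab
  · ext j
    exact congrArg Fin.val (hg j).symm

section Points

variable {X : ℕ → Type u} {d : ∀ n, Fin (n + 2) → X (n + 1) → X n}

/-- The point with given barycentric coordinates in the simplex of a cell. -/
def Realization.mk (d : ∀ n, Fin (n + 2) → X (n + 1) → X n) {n : ℕ} (c : X n)
    (t : stdSimplex ℝ (Fin (n + 1))) : Realization X d :=
  Quot.mk _ ⟨⟨n, c⟩, t⟩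

theorem Realization.isQuotientMap :
    IsQuotientMap (Y := Realization X d) (Quot.mk (FaceRel X d)) :=
  isQuotientMap_quot_mk

theorem Realization.continuous_mk {n : ℕ} (c : X n) : Continuous (Realization.mk d c) :=
  Realization.isQuotientMap.continuous.comp
    (continuous_sigmaMk (ι := Σ n, X n) (i := ⟨n, c⟩))

theorem Realization.mk_face {n : ℕ} (i : Fin (n + 2)) (c : X (n + 1))
    (t : stdSimplex ℝ (Fin (n + 1))) :
    Realization.mk d (d n i c) t = Realization.mk d c (stdSimplex.map i.succAbove t) :=
  Quot.sound (FaceRel.glue n i c t)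

/-- A proper iterated face omits some index `i`, hence factors through the `i`-th face, where the
gluing relation applies; induction on the dimension does the rest. -/
theorem FaceAction.mk_res (A : FaceAction X d) {m n : ℕ} (f : Fin (m + 1) ↪o Fin (n + 1)) (c : X n)
    (t : stdSimplex ℝ (Fin (m + 1))) :
    Realization.mk d (A.res f c) t = Realization.mk d c (stdSimplex.map f t) := by
  induction n with
  | zero =>
    obtain rfl : m = 0 := by
      have := Fintype.card_le_of_injective f f.injective
      simpa using this
    rw [orderEmb_eq_refl f, A.res_refl]
    congr 1
    exact (stdSimplex.map_id_apply t).symm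
  | succ n ih =>
    by_cases hf : Function.Surjective f
    · obtain rfl : m = n + 1 := by
        have := Fintype.card_of_bijective ⟨f.injective, hf⟩
        simpa using this
      rw [orderEmb_eq_refl f, A.res_refl]
      congr 1
      exact (stdSimplex.map_id_apply t).symm
    · obtain ⟨i, hi⟩ := not_forall.1 hf
      obtain ⟨g, rfl⟩ := exists_orderEmb_trans_succAbove f i hi
      rw [← A.res_res, ih, A.res_succAbove, Realization.mk_face, stdSimplex.map_comp_apply]
      rfl

/-- Every point is an interior point of some cell. -/
theorem Realization.exists_mk_eq (x : Realization X d) :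
    ∃ (n : ℕ) (c : X n) (t : stdSimplex ℝ (Fin (n + 1))), (∀ i, 0 < t i) ∧
      Realization.mk d c t = x := by
  obtain ⟨⟨⟨n, c⟩, t⟩, rfl⟩ := Quot.exists_rep x
  change ∃ _, ∃ _, ∃ _, _ ∧ _ = Realization.mk d c t
  induction n with
  | zero =>
    refine ⟨0, c, t, fun i => ?_, rfl⟩
    have : t i = 1 := stdSimplex.eq_one_of_unique (X := Fin 1) t i
    rw [this]
    exact one_pos
  | succ n ih =>
    by_cases h : ∀ i, 0 < t i
    · exact ⟨n + 1, c, t, h, rfl⟩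
    · push Not at h
      obtain ⟨i, hi⟩ := h
      obtain ⟨s, rfl⟩ := exists_stdSimplex_map_succAbove i t (le_antisymm hi (t.2.1 i))
      rw [← Realization.mk_face]
      exact ih _ s

end Points

/-! ### Open stars -/

section Star

variable {X : ℕ → Type u} {d : ∀ n, Fin (n + 2) → X (n + 1) → X n} (A : FaceAction X d)

/-- The point `z` of the disjoint union of the simplices is near the interior of the cell `c`,
regarded as the face `g` of the simplex that contains `z`. -/
structure FaceAction.Near {n : ℕ} (c : X n) (δ : ℝ) (z : SimplexSum X)
    (g : Fin (n + 1) ↪o Fin (z.1.1 + 1)) : Prop where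
  res_eq : A.res g z.1.2 = c
  lt_coord : ∀ i, δ < z.2 (g i)
  coord_lt : ∀ j, j ∉ Set.range g → z.2 j < δ

variable {A}

/-- The range of `g` must be the set of indices whose coordinate exceeds `δ`. Several faces of one
simplex may be the same cell, for instance when a path returns to a vertex, so positivity of
coordinates alone would not single out `g`. -/
theorem FaceAction.Near.unique {n : ℕ} {c : X n} {δ : ℝ} {z : SimplexSum X} {g g' : Fin (n + 1) ↪o Fin (z.1.1 + 1)}
    (h : A.Near c δ z g) (h' : A.Near c δ z g') : g = g' := by
  have key : ∀ {g g' : Fin (n + 1) ↪o Fin (z.1.1 + 1)}, A.Near c δ z g → A.Near c δ z g' →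
      Set.range g ⊆ Set.range g' := by
    rintro g g' h h' _ ⟨i, rfl⟩
    by_contra hi
    exact lt_asymm (h.lt_coord i) (h'.coord_lt _ hi)
  exact DFunLike.coe_injective ((g.strictMono.range_inj g'.strictMono).1
    ((key h h').antisymm (key h' h)))

/-- Passing to a larger simplex only adds a zero coordinate, which is below `δ`. So nearness is
invariant under gluing and stars are well defined on the quotient. -/
theorem FaceAction.near_face_iff {n : ℕ} {c : X n} {δ : ℝ} (hδ : 0 < δ) {n' : ℕ} (i : Fin (n' + 2)) (c' : X (n' + 1))
    (t : stdSimplex ℝ (Fin (n' + 1))) (g : Fin (n + 1) ↪o Fin (n' + 1)) :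
    A.Near c δ ⟨⟨n' + 1, c'⟩, stdSimplex.map i.succAbove t⟩ (g.trans i.succAboveOrderEmb) ↔
      A.Near c δ ⟨⟨n', d n' i c'⟩, t⟩ g := by
  have e : ∀ j, stdSimplex.map i.succAbove t (i.succAbove j) = t j :=
    stdSimplex_map_apply Fin.succAbove_right_injective t
  constructor
  · rintro ⟨h1, h2, h3⟩
    refine ⟨?_, fun j => ?_, fun j hj => ?_⟩
    · rw [← h1, ← A.res_res, A.res_succAbove]
    · rw [← e]
      exact h2 j
    · rw [← e]
      refine h3 _ ?_
      rintro ⟨k, hk⟩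
      exact hj ⟨k, Fin.succAbove_right_injective hk⟩
  · rintro ⟨h1, h2, h3⟩
    refine ⟨?_, fun j => ?_, fun j hj => ?_⟩
    · rw [← h1, ← A.res_res, A.res_succAbove]
    · exact (h2 j).trans_eq (e _).symm
    · rcases Fin.eq_self_or_eq_succAbove i j with h | ⟨k, rfl⟩
      · exact (stdSimplex_map_apply_of_notMem_range t (by simp [h])).trans_lt hδ
      · refine (e k).trans_lt (h3 k ?_)
        rintro ⟨l, rfl⟩
        exact hj ⟨l, rfl⟩

theorem FaceAction.Near.exists_face {n : ℕ} {c : X n} {δ : ℝ} (hδ : 0 < δ) {n' : ℕ} {i : Fin (n' + 2)} {c' : X (n' + 1)}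
    {t : stdSimplex ℝ (Fin (n' + 1))} {g : Fin (n + 1) ↪o Fin (n' + 2)}
    (h : A.Near c δ ⟨⟨n' + 1, c'⟩, stdSimplex.map i.succAbove t⟩ g) :
    ∃ g', g = g'.trans i.succAboveOrderEmb ∧ A.Near c δ ⟨⟨n', d n' i c'⟩, t⟩ g' := by
  obtain ⟨g', rfl⟩ := exists_orderEmb_trans_succAbove g i (by
    rintro ⟨j, hj⟩
    have h1 := h.lt_coord j
    have h2 : stdSimplex.map i.succAbove t (g j) = 0 := by
      rw [hj]
      exact stdSimplex_map_apply_of_notMem_range t (by simp)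
    exact lt_asymm hδ (h1.trans_eq h2))
  exact ⟨g', rfl, (FaceAction.near_face_iff hδ i c' t g').1 h⟩

/-- An open neighborhood of the points of the cell `c` whose coordinates are greater than `δ`. -/
def FaceAction.star (A : FaceAction X d) {n : ℕ} (c : X n) {δ : ℝ} (hδ : 0 < δ) : Set (Realization X d) :=
  {x | Quot.liftOn x (fun z => ∃ g, A.Near c δ z g) (by
    rintro _ _ ⟨n', i, c', t⟩
    refine propext ⟨fun ⟨g, hg⟩ => ⟨_, (FaceAction.near_face_iff hδ i c' t g).2 hg⟩, ?_⟩
    rintro ⟨g, hg⟩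
    obtain ⟨g', -, hg'⟩ := hg.exists_face hδ
    exact ⟨g', hg'⟩)}

theorem FaceAction.near_self {n : ℕ} {c : X n} {δ : ℝ} (t : stdSimplex ℝ (Fin (n + 1)))
    (ht : ∀ i, δ < t i) : A.Near c δ ⟨⟨n, c⟩, t⟩ (RelEmbedding.refl _) :=
  ⟨A.res_refl c, ht, fun j hj => absurd ⟨j, rfl⟩ hj⟩

theorem FaceAction.Near.eventually {n : ℕ} {c : X n} {δ : ℝ} {z : SimplexSum X} {g : Fin (n + 1) ↪o Fin (z.1.1 + 1)}
    (h : A.Near c δ z g) :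
    ∀ᶠ t in 𝓝 z.2, A.Near c δ ⟨z.1, t⟩ g := by
  have hc : ∀ j, Continuous fun t : stdSimplex ℝ (Fin (z.1.1 + 1)) => t j := fun j =>
    (continuous_apply j).comp continuous_subtype_val
  have h1 : ∀ᶠ t in 𝓝 z.2, ∀ i, δ < t (g i) := Filter.eventually_all.2 fun i =>
    (hc _).continuousAt.eventually_const_lt (h.lt_coord i)
  have h2 : ∀ᶠ t in 𝓝 z.2, ∀ j, j ∉ Set.range g → t j < δ := Filter.eventually_all.2 fun j => by
    by_cases hj : j ∈ Set.range g
    · exact Filter.Eventually.of_forall fun t ht => absurd hj ht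
    · exact ((hc j).continuousAt.eventually_lt_const (h.coord_lt j hj)).mono fun t ht _ => ht
  filter_upwards [h1, h2] with t ht1 ht2
  exact ⟨h.res_eq, ht1, ht2⟩

theorem FaceAction.isOpen_star {n : ℕ} {c : X n} {δ : ℝ} (hδ : 0 < δ) : IsOpen (A.star c hδ) := by
  rw [← (Realization.isQuotientMap (X := X) (d := d)).isOpen_preimage, isOpen_iff_mem_nhds]
  rintro ⟨a, t⟩ ⟨g, hg⟩
  rw [Sigma.nhds_mk, Filter.mem_map]
  filter_upwards [hg.eventually] with s hs
  exact ⟨g, hs⟩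

/-- Functions on a star are obtained from functions on the simplices that are compatible
with the faces. -/
theorem FaceAction.exists_continuousOn_star {n : ℕ} {c : X n} {δ : ℝ} (hδ : 0 < δ) {T : Type*} [TopologicalSpace T]
    [Nonempty T] (Ψ : ∀ z : SimplexSum X, (Fin (n + 1) ↪o Fin (z.1.1 + 1)) → T)
    (hΨ : ∀ (n' : ℕ) (i : Fin (n' + 2)) (c' : X (n' + 1)) (t : stdSimplex ℝ (Fin (n' + 1)))
      (g : Fin (n + 1) ↪o Fin (n' + 1)), A.Near c δ ⟨⟨n', d n' i c'⟩, t⟩ g →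
      Ψ ⟨⟨n', d n' i c'⟩, t⟩ g =
        Ψ ⟨⟨n' + 1, c'⟩, stdSimplex.map i.succAbove t⟩ (g.trans i.succAboveOrderEmb))
    (hcont : ∀ (a : Σ n, X n) (g : Fin (n + 1) ↪o Fin (a.1 + 1)), A.res g a.2 = c →
      Continuous fun t => Ψ ⟨a, t⟩ g) :
    ∃ F : Realization X d → T, ContinuousOn F (A.star c hδ) ∧
      ∀ z g, A.Near c δ z g → F (Quot.mk _ z) = Ψ z g := by
  classical
  -- The value off the star is arbitrary but constant, so that `F₀` still respects the gluing there.
  let F₀ : SimplexSum X → T := fun z =>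
    if h : ∃ g, A.Near c δ z g then Ψ z h.choose else Classical.arbitrary T
  have hF₀ : ∀ z g, A.Near c δ z g → F₀ z = Ψ z g := fun z g hg => by
    have h : ∃ g, A.Near c δ z g := ⟨g, hg⟩
    simp only [F₀, dif_pos h]
    rw [h.choose_spec.unique hg]
  let F : Realization X d → T := Quot.lift F₀ (by
    rintro _ _ ⟨n', i, c', t⟩
    by_cases h : ∃ g, A.Near c δ ⟨⟨n', d n' i c'⟩, t⟩ g
    · obtain ⟨g, hg⟩ := h
      rw [hF₀ _ g hg, hΨ _ _ _ _ _ hg, hF₀ _ _ ((FaceAction.near_face_iff hδ i c' t g).2 hg)]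
    · have h' : ¬ ∃ g, A.Near c δ ⟨⟨n' + 1, c'⟩, stdSimplex.map i.succAbove t⟩ g := by
        rintro ⟨g, hg⟩
        obtain ⟨g', -, hg'⟩ := hg.exists_face hδ
        exact h ⟨g', hg'⟩
      simp only [F₀, dif_neg h, dif_neg h'])
  refine ⟨F, ?_, hF₀⟩
  -- The star is open, so continuity on it may be tested in the disjoint union of the simplices.
  rw [(Realization.isQuotientMap (X := X) (d := d)).continuousOn_isOpen_iff (FaceAction.isOpen_star hδ)]
  rintro ⟨a, t⟩ ⟨g, hg⟩
  refine ContinuousAt.continuousWithinAt ?_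
  have h1 : Filter.Tendsto (fun s => Ψ ⟨a, s⟩ g) (𝓝 t) (𝓝 (Ψ ⟨a, t⟩ g)) :=
    (hcont a g hg.res_eq).continuousAt
  change Filter.Tendsto F₀ (𝓝 _) (𝓝 (F₀ _))
  rw [Sigma.nhds_mk, Filter.tendsto_map'_iff, hF₀ _ g hg]
  refine h1.congr' ?_
  filter_upwards [hg.eventually] with s hs
  exact (hF₀ ⟨a, s⟩ g hs).symm

/-- A star contracts linearly to any interior point of its cell. -/
theorem FaceAction.exists_contraction {n : ℕ} {c : X n} {δ : ℝ} (hδ : 0 < δ) (t : stdSimplex ℝ (Fin (n + 1))) :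
    ∃ H : Realization X d → C(I, Realization X d), ContinuousOn H (A.star c hδ) ∧
      ∀ (n' : ℕ) (c' : X n') (s : stdSimplex ℝ (Fin (n' + 1))) (g : Fin (n + 1) ↪o Fin (n' + 1)),
        A.Near c δ ⟨⟨n', c'⟩, s⟩ g →
        ∀ r, H (Realization.mk d c' s) r =
          Realization.mk d c' (simplexSegment (r, s, stdSimplex.map g t)) := by
  have hc : ∀ (a : Σ n, X n) (g : Fin (n + 1) ↪o Fin (a.1 + 1)),
      Continuous fun p : stdSimplex ℝ (Fin (a.1 + 1)) × I =>
        Realization.mk d a.2 (simplexSegment (p.2, p.1, stdSimplex.map g t)) := fun a g =>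
    (Realization.continuous_mk a.2).comp (continuous_simplexSegment.comp (by fun_prop))
  have : Nonempty C(I, Realization X d) := ⟨ContinuousMap.const _ (Realization.mk d c t)⟩
  -- The homotopy is a map into the space `C(I, Realization X d)`; this way only the star has to be
  -- treated as a quotient, and not its product with `I`.
  obtain ⟨F, hF, hF'⟩ := FaceAction.exists_continuousOn_star (A := A) (c := c) hδ
    (T := C(I, Realization X d))
    (fun z g => ContinuousMap.curry ⟨_, hc z.1 g⟩ z.2) (by
      intro n' i c' s g hg
      ext r
      simp only [ContinuousMap.curry_apply, ContinuousMap.coe_mk]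
      rw [Realization.mk_face, map_simplexSegment, stdSimplex.map_comp_apply]
      rfl) (fun a g _ => (ContinuousMap.curry ⟨_, hc a g⟩).continuous)
  refine ⟨F, hF, fun n' c' s g hg r => ?_⟩
  rw [Realization.mk, hF' _ g hg]
  rfl

end Star

end BoundQuiver

/-! ### Covering maps from unique lifting of cells. -/

namespace BoundQuiver

open Topology

/-! ### Vertices of cells -/

/-- The inclusion of the vertex `i`. -/
def vertexEmb {n : ℕ} (i : Fin (n + 1)) : Fin (0 + 1) ↪o Fin (n + 1) :=
  OrderEmbedding.ofStrictMono (fun _ => i) (Subsingleton.strictMono (α := Fin 1) _)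

section Vertices

variable {X : ℕ → Type u} {d : ∀ n, Fin (n + 2) → X (n + 1) → X n} (A : FaceAction X d)

/-- The vertex `i` of a cell. -/
def FaceAction.vtx {n : ℕ} (i : Fin (n + 1)) (c : X n) : X 0 := A.res (vertexEmb i) c

theorem FaceAction.vtx_res {m n : ℕ} (f : Fin (m + 1) ↪o Fin (n + 1)) (i : Fin (m + 1)) (c : X n) :
    A.vtx i (A.res f c) = A.vtx (f i) c := by
  rw [vtx, A.res_res]
  rfl

end Vertices

/-! ### Coverings of realizations -/

section Covering

variable {X Y : ℕ → Type u} {d : ∀ n, Fin (n + 2) → X (n + 1) → X n}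
  {e : ∀ n, Fin (n + 2) → Y (n + 1) → Y n}

theorem Realization.continuous_map (f : ∀ n, X n → Y n)
    (hf : ∀ n i c, f n (d n i c) = e n i (f (n + 1) c)) :
    Continuous (Realization.map f hf : Realization X d → Realization Y e) := by
  refine (Realization.isQuotientMap (X := X) (d := d)).continuous_iff.2 ?_
  rw [continuous_sigma_iff]
  intro a
  exact Realization.continuous_mk (d := e) (f a.1 a.2)

/-- A map of cells that commutes with faces and that has unique lifts of cells through
given lifts of one of their vertices. -/
structure IsCellCovering (A : FaceAction X d) (B : FaceAction Y e) (f : ∀ n, X n → Y n) :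
    Prop where
  map_res : ∀ {m n : ℕ} (g : Fin (m + 1) ↪o Fin (n + 1)) (c : X n),
    f m (A.res g c) = B.res g (f n c)
  exists_lift : ∀ {n : ℕ} (i : Fin (n + 1)) (c : Y n) (v : X 0), f 0 v = B.vtx i c →
    ∃ c' : X n, f n c' = c ∧ A.vtx i c' = v
  eq_of_vtx : ∀ {n : ℕ} (i : Fin (n + 1)) (c c' : X n), f n c = f n c' → A.vtx i c = A.vtx i c' →
    c = c'

variable {A : FaceAction X d} {B : FaceAction Y e} {f : ∀ n, X n → Y n}

theorem IsCellCovering.eq_of_res (h : IsCellCovering A B f) {m n : ℕ}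
    (g : Fin (m + 1) ↪o Fin (n + 1)) {c c' : X n} (hc : f n c = f n c')
    (hg : A.res g c = A.res g c') : c = c' := by
  refine h.eq_of_vtx (g 0) c c' hc ?_
  rw [← A.vtx_res, ← A.vtx_res, hg]

/-- Lift `c'` through one vertex of `c`. The face `g` of the lift and `c` then lie over the same
cell and share a vertex, hence coincide. -/
theorem IsCellCovering.exists_lift_res (h : IsCellCovering A B f) {m n : ℕ}
    (g : Fin (m + 1) ↪o Fin (n + 1)) (c : X m) (c' : Y n) (hc : B.res g c' = f m c) :
    ∃ b : X n, f n b = c' ∧ A.res g b = c := by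
  obtain ⟨b, hb, hv⟩ := h.exists_lift (g 0) c' (A.vtx 0 c) (by
    rw [FaceAction.vtx, h.map_res, ← hc]
    exact B.vtx_res g 0 c')
  refine ⟨b, hb, h.eq_of_vtx 0 _ _ ?_ ?_⟩
  · rw [h.map_res, hb, hc]
  · rw [A.vtx_res, hv]

theorem IsCellCovering.near_map (h : IsCellCovering A B f) {n : ℕ} {c : X n} {δ : ℝ} {n' : ℕ}
    {c' : X n'} {t : stdSimplex ℝ (Fin (n' + 1))} {g : Fin (n + 1) ↪o Fin (n' + 1)}
    (hg : A.Near c δ ⟨⟨n', c'⟩, t⟩ g) : B.Near (f n c) δ ⟨⟨n', f n' c'⟩, t⟩ g :=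
  ⟨by rw [← hg.res_eq, h.map_res], hg.lt_coord, hg.coord_lt⟩

section Local

variable {n : ℕ} {c : Y n} {δ : ℝ}

/-- With `eq_of_mem_star`, this makes the inverse image of a star the disjoint union of the stars of
the lifts of its cell. -/
theorem IsCellCovering.exists_mem_star (h : IsCellCovering A B f)
    (hf : ∀ n i c, f n (d n i c) = e n i (f (n + 1) c)) (hδ : 0 < δ)
    {x : Realization X d}
    (hx : Realization.map f hf x ∈ B.star c hδ) : ∃ b : X n, f n b = c ∧ x ∈ A.star b hδ := by
  obtain ⟨⟨⟨n', c'⟩, t⟩, rfl⟩ := Quot.exists_rep x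
  obtain ⟨g, hg⟩ := hx
  refine ⟨A.res g c', ?_, g, rfl, hg.lt_coord, hg.coord_lt⟩
  rw [h.map_res]
  exact hg.res_eq

theorem IsCellCovering.eq_of_mem_star (h : IsCellCovering A B f)
    (hδ : 0 < δ)
    {b b' : X n} (hb : f n b = f n b')
    {x : Realization X d} (hx : x ∈ A.star b hδ) (hx' : x ∈ A.star b' hδ) : b = b' := by
  obtain ⟨⟨⟨n', c'⟩, t⟩, rfl⟩ := Quot.exists_rep x
  obtain ⟨g, hg⟩ := hx
  obtain ⟨g', hg'⟩ := hx'
  have := (h.near_map hg).unique (hb ▸ h.near_map hg')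
  rw [← hg.res_eq, ← hg'.res_eq, this]

/-- The sheet through `b`: a point near `c` along the face `g` of a simplex goes to the point with
the same coordinates in the only lift of that simplex whose face `g` is `b`. -/
theorem IsCellCovering.exists_section (h : IsCellCovering A B f)
    (hf : ∀ n i c, f n (d n i c) = e n i (f (n + 1) c)) (hδ : 0 < δ)
    (b : X n) (hb : f n b = c) :
    ∃ s : Realization Y e → Realization X d, ContinuousOn s (B.star c hδ) ∧
      (∀ y ∈ B.star c hδ, s y ∈ A.star b hδ ∧ Realization.map f hf (s y) = y) ∧
      ∀ x ∈ A.star b hδ, s (Realization.map f hf x) = x := by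
  classical
  subst hb
  have hl : ∀ (z : SimplexSum Y) (g : Fin (n + 1) ↪o Fin (z.1.1 + 1)), ∃ x : Realization X d,
      ∀ c' : X z.1.1, f _ c' = z.1.2 → A.res g c' = b → x = Realization.mk d c' z.2 := by
    intro z g
    by_cases hg : B.res g z.1.2 = f n b
    · obtain ⟨b', hb', hr⟩ := h.exists_lift_res g b z.1.2 hg
      refine ⟨Realization.mk d b' z.2, fun c' hc' hr' => ?_⟩
      rw [h.eq_of_res g (hb'.trans hc'.symm) (hr.trans hr'.symm)]
    -- If the face `g` does not lie under `b`, no lift qualifies, and any point serves as value.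
    · refine ⟨Realization.mk d b (stdSimplex.vertex 0), fun c' hc' hr' => absurd ?_ hg⟩
      rw [← hc', ← h.map_res, hr']
  choose Ψ hΨ using hl
  have : Nonempty (Realization X d) := ⟨Realization.mk d b (stdSimplex.vertex 0)⟩
  obtain ⟨s, hs, hs'⟩ := FaceAction.exists_continuousOn_star (A := B) (c := f n b) hδ Ψ (by
    intro n' i c' t g hg
    obtain ⟨b', hb', hr⟩ := h.exists_lift_res (g.trans i.succAboveOrderEmb) b c' (by
      rw [← B.res_res, B.res_succAbove]
      exact hg.res_eq)
    have h1 := hΨ ⟨⟨n', e n' i c'⟩, t⟩ g (d n' i b') (by rw [hf, hb']) (by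
      rw [← A.res_succAbove, A.res_res, hr])
    exact h1.trans ((Realization.mk_face i b' t).trans
      (hΨ ⟨⟨n' + 1, c'⟩, stdSimplex.map i.succAbove t⟩ _ b' hb' hr).symm)) (by
    intro a g hg
    obtain ⟨b', hb', hr⟩ := h.exists_lift_res g b a.2 hg
    have : (fun t => Ψ ⟨a, t⟩ g) = Realization.mk d b' := funext fun t => hΨ ⟨a, t⟩ g b' hb' hr
    rw [this]
    exact Realization.continuous_mk b')
  refine ⟨s, hs, fun y hy => ?_, fun x hx => ?_⟩
  · obtain ⟨⟨⟨n', c'⟩, t⟩, rfl⟩ := Quot.exists_rep y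
    obtain ⟨g, hg⟩ := hy
    obtain ⟨b', hb', hr⟩ := h.exists_lift_res g b c' hg.res_eq
    dsimp only at b' hb'
    subst hb'
    rw [hs' _ _ hg, hΨ _ _ b' rfl hr]
    exact ⟨⟨g, hr, hg.lt_coord, hg.coord_lt⟩, rfl⟩
  · obtain ⟨⟨⟨n', c'⟩, t⟩, rfl⟩ := Quot.exists_rep x
    obtain ⟨g, hg⟩ := hx
    exact (hs' _ _ (h.near_map hg)).trans (hΨ ⟨⟨n', f n' c'⟩, t⟩ _ c' rfl hg.res_eq)

end Local

theorem IsCellCovering.isCoveringMap (h : IsCellCovering A B f)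
    (hf : ∀ n i c, f n (d n i c) = e n i (f (n + 1) c)) :
    IsCoveringMap (Realization.map f hf : Realization X d → Realization Y e) := by
  intro y
  obtain ⟨n, c, t, ht, rfl⟩ := Realization.exists_mk_eq y
  obtain ⟨δ, hδ, hδt⟩ := exists_lt_forall_coord t ht
  let _ : TopologicalSpace {b : X n // f n b = c} := ⊥
  have : DiscreteTopology {b : X n // f n b = c} := ⟨rfl⟩
  have hcont := Realization.continuous_map f hf
  choose s hs hs1 hs2 using fun b : {b : X n // f n b = c} => h.exists_section hf hδ b.1 b.2
  have hex : ∀ x : Realization.map f hf ⁻¹' B.star c hδ,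
      ∃ b : {b : X n // f n b = c}, x.1 ∈ A.star b.1 hδ := fun x => by
    obtain ⟨b, hb, hx⟩ := h.exists_mem_star hf hδ x.2
    exact ⟨⟨b, hb⟩, hx⟩
  choose φ hφ using hex
  -- The index of the sheet is determined by the point, and it is locally constant because stars are
  -- open.
  have hφu : ∀ x b, x.1 ∈ A.star b.1 hδ → φ x = b := fun x b hb =>
    Subtype.ext (h.eq_of_mem_star hδ ((φ x).2.trans b.2.symm) (hφ x) hb)
  have hφc : Continuous φ := by
    rw [continuous_iff_continuousAt]
    intro x
    refine (continuousAt_const (y := φ x)).congr ?_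
    filter_upwards [((FaceAction.isOpen_star hδ).preimage continuous_subtype_val).mem_nhds (hφ x)]
      with x' hx'
    exact (hφu x' _ hx').symm
  -- The sheets are indexed by the lifts of the cell `c`; this index set is then traded for the
  -- fibre of the point.
  refine IsEvenlyCovered.to_isEvenlyCovered_preimage (I := {b : X n // f n b = c})
    ⟨inferInstance, B.star c hδ, ⟨_, FaceAction.near_self t hδt⟩, FaceAction.isOpen_star hδ,
      (FaceAction.isOpen_star hδ).preimage hcont, ?_⟩
  refine ⟨{ toFun := fun x => (⟨_, x.2⟩, φ x)
            invFun := fun p => ⟨s p.2 p.1.1, by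
              rw [Set.mem_preimage, (hs1 p.2 _ p.1.2).2]
              exact p.1.2⟩
            left_inv := fun x => Subtype.ext (hs2 _ _ (hφ x))
            right_inv := fun p => Prod.ext (Subtype.ext (hs1 p.2 _ p.1.2).2)
              (hφu _ _ (hs1 p.2 _ p.1.2).1)
            continuous_toFun := by fun_prop
            continuous_invFun := ?_ }, fun x => rfl⟩
  refine Continuous.subtype_mk (continuous_prod_of_discrete_right.2 fun b => ?_) _
  exact (continuousOn_iff_continuous_domRestrict.1 (hs b))

end Covering

end BoundQuiver

/-! ### A criterion for simple connectivity of a realization. -/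

namespace BoundQuiver

open unitInterval Topology

/-! ### Homotopy classes of paths -/

section PathClasses

variable {S T : Type*} [TopologicalSpace S] [TopologicalSpace T]

/-- Glued points are equal only propositionally, so classes have to be transported between
endpoints. This and the next lemmas move the transport out of the way. -/
theorem trans_cast_cast {x y z x' y' z' : S} (γ : Path.Homotopic.Quotient x y)
    (γ' : Path.Homotopic.Quotient y z) (hx : x' = x) (hy : y' = y) (hz : z' = z) :
    (γ.cast hx hy).trans (γ'.cast hy hz) = (γ.trans γ').cast hx hz := by
  subst hx hy hz
  simp

theorem eqRec_eq_cast {x y z : S} (h : y = z) (γ : Path.Homotopic.Quotient x y) :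
    (h ▸ γ : Path.Homotopic.Quotient x z) = γ.cast rfl h.symm := by
  subst h
  simp

theorem family_eq_cast {α : Type*} {x : S} {P : α → S} (k : ∀ a, Path.Homotopic.Quotient x (P a))
    {a b : α} (h : a = b) : k a = (k b).cast rfl (congrArg P h) := by
  subst h
  simp

theorem trans_right_cancel {x y z : S} {γ γ' : Path.Homotopic.Quotient x y}
    (δ : Path.Homotopic.Quotient y z) (h : γ.trans δ = γ'.trans δ) : γ = γ' := by
  have := congrArg (fun ε => ε.trans δ.symm) h
  simpa using this

theorem trans_left_cancel {x y z : S} {γ γ' : Path.Homotopic.Quotient y z}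
    (δ : Path.Homotopic.Quotient x y) (h : δ.trans γ = δ.trans γ') : γ = γ' := by
  have := congrArg (fun ε => δ.symm.trans ε) h
  simpa [← Path.Homotopic.Quotient.trans_assoc] using this

/-- In a square, if three sides are given by `γ`, and two constant paths, then `γ` followed by
the fourth side is null-homotopic. -/
theorem trans_eq_refl_of_square (F : C(I × I, S)) {x y : S} (γ δ : C(I, S)) (h0 : ∀ a, F (a, 0) = γ a)
    (h1 : ∀ b, F (1, b) = δ b) (h2 : ∀ b, F (0, b) = x) (h3 : ∀ a, F (a, 1) = x)
    (γ' : Path x y) (hγ : ∀ a, γ' a = γ a) (δ' : Path y x) (hδ : ∀ a, δ' a = δ a) :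
    (Path.Homotopic.Quotient.mk γ').trans (Path.Homotopic.Quotient.mk δ') =
      Path.Homotopic.Quotient.refl x := by
  let p1 : Path ((0, 0) : I × I) (1, 0) := ⟨⟨fun a => (a, 0), by fun_prop⟩, rfl, rfl⟩
  let p2 : Path ((1, 0) : I × I) (1, 1) := ⟨⟨fun a => (1, a), by fun_prop⟩, rfl, rfl⟩
  let p3 : Path ((0, 0) : I × I) (0, 1) := ⟨⟨fun a => (0, a), by fun_prop⟩, rfl, rfl⟩
  let p4 : Path ((0, 1) : I × I) (1, 1) := ⟨⟨fun a => (a, 1), by fun_prop⟩, rfl, rfl⟩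
  have : ContractibleSpace I := (convex_Icc (0 : ℝ) 1).contractibleSpace ⟨0, by simp⟩
  -- The two ways around the boundary of the square are homotopic in the square; `F` carries this
  -- homotopy to `S`.
  have key : Path.Homotopic (p1.trans p2) (p3.trans p4) := SimplyConnectedSpace.paths_homotopic _ _
  have key2 := Path.Homotopic.Quotient.eq.2 (key.map F)
  have e00 : x = F (0, 0) := (h2 0).symm
  have e11 : x = F (1, 1) := (h3 1).symm
  have e10 : y = F (1, 0) := by
    rw [h0, ← hγ, γ'.target]
  have e01 : x = F (0, 1) := (h2 1).symm
  have key3 := congrArg (fun ε => Path.Homotopic.Quotient.cast ε e00 e11) key2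
  have g1 : ((p1.map F.continuous).cast e00 e10) = γ' := by
    ext a
    exact (h0 a).trans (hγ a).symm
  have g2 : ((p2.map F.continuous).cast e10 e11) = δ' := by
    ext a
    exact (h1 a).trans (hδ a).symm
  have g3 : ((p3.map F.continuous).cast e00 e01) = Path.refl x := by
    ext a
    exact h2 a
  have g4 : ((p4.map F.continuous).cast e01 e11) = Path.refl x := by
    ext a
    exact h3 a
  rw [Path.map_trans, Path.map_trans, Path.Homotopic.Quotient.mk_trans,
    Path.Homotopic.Quotient.mk_trans] at key3
  rw [← trans_cast_cast _ _ e00 e10 e11, ← trans_cast_cast _ _ e00 e01 e11] at key3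
  simp only [← Path.Homotopic.Quotient.mk_cast] at key3
  rw [g1, g2, g3, g4] at key3
  rw [key3]
  simp

/-- A family of classes of paths from a fixed point to all the points, which is locally
compatible with paths, is compatible with all paths. -/
theorem trans_eq_of_locally {x₀ : S} (κ : ∀ x, Path.Homotopic.Quotient x₀ x)
    (hκ : ∀ x, ∃ U ∈ 𝓝 x, ∀ (y : S) (γ : Path x y), (∀ r, γ r ∈ U) →
      (κ x).trans (Path.Homotopic.Quotient.mk γ) = κ y) {x y : S} (γ : Path x y) :
    (κ x).trans (Path.Homotopic.Quotient.mk γ) = κ y := by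
  have hloc : ∀ r : I, ∀ᶠ r' in 𝓝 r,
      (κ (γ r)).trans (Path.Homotopic.Quotient.mk (γ.subpath r r')) = κ (γ r') := by
    intro r
    obtain ⟨U, hU, h⟩ := hκ (γ r)
    have h1 : ∀ᶠ r' in 𝓝 r, Set.uIcc r r' ⊆ γ ⁻¹' U :=
      (tendsto_const_nhds.uIcc Filter.tendsto_id).eventually
        (Filter.eventually_smallSets_subset.2 (γ.continuous.continuousAt hU))
    filter_upwards [h1] with r' hr'
    refine h _ _ fun s => ?_
    have : γ.subpath r r' s ∈ Set.range (γ.subpath r r') := ⟨s, rfl⟩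
    rw [Path.range_subpath] at this
    obtain ⟨q, hq, e⟩ := this
    rw [← e]
    exact hr' hq
  -- The set of `r` satisfying `P` is open and closed: near `r`, compatibility along the short piece
  -- from `r` to `r'` transfers `P` one way, and cancelling that piece transfers it back.
  let P : I → Prop := fun r =>
    (κ (γ 0)).trans (Path.Homotopic.Quotient.mk (γ.subpath 0 r)) = κ (γ r)
  have hP : ∀ r, ∀ᶠ r' in 𝓝 r, (P r' ↔ P r) := by
    intro r
    filter_upwards [hloc r] with r' hr'
    have e : Path.Homotopic.Quotient.mk (γ.subpath 0 r') =
        (Path.Homotopic.Quotient.mk (γ.subpath 0 r)).trans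
          (Path.Homotopic.Quotient.mk (γ.subpath r r')) := by
      rw [← Path.Homotopic.Quotient.mk_trans]
      exact (Path.Homotopic.Quotient.eq.2 ⟨Path.Homotopy.subpathTransSubpath γ 0 r r'⟩).symm
    simp only [P]
    rw [e, ← hr', ← Path.Homotopic.Quotient.trans_assoc]
    exact ⟨trans_right_cancel _, fun h => by rw [h]⟩
  have hclopen : IsClopen {r | P r} := by
    constructor
    · rw [← isOpen_compl_iff, isOpen_iff_mem_nhds]
      intro r hr
      filter_upwards [hP r] with r' hr'
      exact fun h => hr (hr'.1 h)
    · rw [isOpen_iff_mem_nhds]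
      intro r hr
      filter_upwards [hP r] with r' hr'
      exact hr'.2 hr
  have h0 : P 0 := by
    simp only [P, Path.subpath_self, Path.Homotopic.Quotient.mk_refl,
      Path.Homotopic.Quotient.trans_refl]
  have h1 : P 1 := by
    have := hclopen.eq_univ ⟨0, h0⟩
    exact Set.eq_univ_iff_forall.1 this 1
  simp only [P, Path.subpath_zero_one, Path.Homotopic.Quotient.mk_cast] at h1
  rw [family_eq_cast κ γ.source, family_eq_cast κ γ.target,
    trans_cast_cast _ _ rfl γ.source γ.target] at h1
  have := congrArg (fun ε => ε.cast rfl γ.target.symm) h1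
  simpa using this

end PathClasses

/-! ### Simple connectivity of realizations -/

section SimplyConnected

variable {X : ℕ → Type u} {d : ∀ n, Fin (n + 2) → X (n + 1) → X n}

/-- The point of a vertex. -/
noncomputable def Realization.pt (d : ∀ n, Fin (n + 2) → X (n + 1) → X n) (v : X 0) :
    Realization X d :=
  Realization.mk d v (stdSimplex.vertex 0)

/-- The homotopy class of the paths in the simplex of `c` between two given points. -/
noncomputable def Realization.simplexClass (d : ∀ n, Fin (n + 2) → X (n + 1) → X n) {n : ℕ}
    (c : X n) (s t : stdSimplex ℝ (Fin (n + 1))) :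
    Path.Homotopic.Quotient (Realization.mk d c s) (Realization.mk d c t) :=
  Path.Homotopic.Quotient.mk ((PathConnectedSpace.somePath s t).map (Realization.continuous_mk c))

/-- The simplex is simply connected, so the class does not depend on the path chosen in it. -/
theorem Realization.mk_map_eq {n : ℕ} (c : X n) {s t : stdSimplex ℝ (Fin (n + 1))} (γ : Path s t) :
    Path.Homotopic.Quotient.mk (γ.map (Realization.continuous_mk (d := d) c)) =
      Realization.simplexClass d c s t :=
  Path.Homotopic.Quotient.eq.2
    ((SimplyConnectedSpace.paths_homotopic γ _).map ⟨_, Realization.continuous_mk c⟩)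

theorem Realization.simplexClass_trans {n : ℕ} (c : X n) (s t r : stdSimplex ℝ (Fin (n + 1))) :
    (Realization.simplexClass d c s t).trans (Realization.simplexClass d c t r) =
      Realization.simplexClass d c s r := by
  rw [← Realization.mk_map_eq (d := d) c
    ((PathConnectedSpace.somePath s t).trans (PathConnectedSpace.somePath t r)), Path.map_trans]
  rfl

theorem FaceAction.simplexClass_res (A : FaceAction X d) {m n : ℕ}
    (f : Fin (m + 1) ↪o Fin (n + 1)) (c : X n) (s t : stdSimplex ℝ (Fin (m + 1))) :
    Realization.simplexClass d (A.res f c) s t =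
      (Realization.simplexClass d c (stdSimplex.map f s) (stdSimplex.map f t)).cast
        (A.mk_res f c s) (A.mk_res f c t) := by
  rw [← Realization.mk_map_eq (d := d) c
    ((PathConnectedSpace.somePath s t).map (stdSimplex.continuous_map f)),
    ← Path.Homotopic.Quotient.mk_cast]
  refine congrArg Path.Homotopic.Quotient.mk (Path.ext ?_)
  funext r
  exact A.mk_res f c _

theorem FaceAction.mk_vertex (A : FaceAction X d) {n : ℕ} (c : X n) (i : Fin (n + 1)) :
    Realization.pt d (A.vtx i c) = Realization.mk d c (stdSimplex.vertex i) := by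
  rw [Realization.pt, FaceAction.vtx, A.mk_res, stdSimplex.map_vertex]
  rfl

/-- The class of the edge between two vertices of a cell. -/
noncomputable def FaceAction.edgeClass (A : FaceAction X d) {n : ℕ} (c : X n) (i j : Fin (n + 1)) :
    Path.Homotopic.Quotient (Realization.pt d (A.vtx i c)) (Realization.pt d (A.vtx j c)) :=
  (Realization.simplexClass d c (stdSimplex.vertex i) (stdSimplex.vertex j)).cast
    (A.mk_vertex c i) (A.mk_vertex c j)

theorem FaceAction.edgeClass_trans (A : FaceAction X d) {n : ℕ} (c : X n) (i j l : Fin (n + 1)) :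
    (A.edgeClass c i j).trans (A.edgeClass c j l) = A.edgeClass c i l := by
  unfold FaceAction.edgeClass
  rw [trans_cast_cast, Realization.simplexClass_trans]

theorem FaceAction.edgeClass_res (A : FaceAction X d) {m n : ℕ} (f : Fin (m + 1) ↪o Fin (n + 1))
    (c : X n) (i j : Fin (m + 1)) :
    A.edgeClass (A.res f c) i j = (A.edgeClass c (f i) (f j)).cast
      (congrArg _ (A.vtx_res f i c)) (congrArg _ (A.vtx_res f j c)) := by
  have h : ∀ (a b a' b' : stdSimplex ℝ (Fin (n + 1))) (ha : a = a') (hb : b = b'),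
      Realization.simplexClass d c a b = (Realization.simplexClass d c a' b').cast
        (congrArg _ ha) (congrArg _ hb) := by
    rintro a b _ _ rfl rfl
    simp
  unfold FaceAction.edgeClass
  rw [A.simplexClass_res, h _ _ _ _ (stdSimplex.map_vertex f i) (stdSimplex.map_vertex f j)]
  simp

/-- The inclusion of an edge. -/
def edgeEmb {n : ℕ} {i j : Fin (n + 1)} (h : i < j) : Fin (1 + 1) ↪o Fin (n + 1) :=
  OrderEmbedding.ofStrictMono ![i, j] (by
    intro a b hab
    fin_cases a <;> fin_cases b <;> first | exact h | exact absurd hab (by decide))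

section Criterion

variable (A : FaceAction X d) {x₀ : Realization X d}
  (k : ∀ v : X 0, Path.Homotopic.Quotient x₀ (Realization.pt d v))

/-- The class of a path to a point of the simplex of `c`, through the vertex `i` of `c`. -/
noncomputable def FaceAction.throughVertex {n : ℕ} (c : X n) (i : Fin (n + 1))
    (s : stdSimplex ℝ (Fin (n + 1))) : Path.Homotopic.Quotient x₀ (Realization.mk d c s) :=
  (k (A.vtx i c)).trans
    ((Realization.simplexClass d c (stdSimplex.vertex i) s).cast (A.mk_vertex c i) rfl)

theorem FaceAction.throughVertex_trans {n : ℕ} (c : X n) (i : Fin (n + 1))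
    (s t : stdSimplex ℝ (Fin (n + 1))) :
    (A.throughVertex k c i s).trans (Realization.simplexClass d c s t) =
      A.throughVertex k c i t := by
  unfold FaceAction.throughVertex
  have := trans_cast_cast (Realization.simplexClass d c (stdSimplex.vertex i) s)
    (Realization.simplexClass d c s t) (A.mk_vertex c i) rfl rfl
  rw [Path.Homotopic.Quotient.cast_rfl_rfl, Realization.simplexClass_trans] at this
  rw [Path.Homotopic.Quotient.trans_assoc, this]

/-- The hypothesis concerns the forward edge of each 1-cell; restriction to an edge gives `i < j`,
and inverting gives `i > j`. -/
theorem FaceAction.trans_edgeClass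
    (hk : ∀ c : X 1, (k (A.vtx 0 c)).trans (A.edgeClass c 0 1) = k (A.vtx 1 c))
    {n : ℕ} (c : X n) (i j : Fin (n + 1)) :
    (k (A.vtx i c)).trans (A.edgeClass c i j) = k (A.vtx j c) := by
  have hlt : ∀ i j : Fin (n + 1), i < j →
      (k (A.vtx i c)).trans (A.edgeClass c i j) = k (A.vtx j c) := by
    intro i j hij
    have h := hk (A.res (edgeEmb hij) c)
    have e0 : A.vtx 0 (A.res (edgeEmb hij) c) = A.vtx i c := A.vtx_res _ _ _
    have e1 : A.vtx 1 (A.res (edgeEmb hij) c) = A.vtx j c := A.vtx_res _ _ _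
    rw [family_eq_cast k e0, family_eq_cast k e1, A.edgeClass_res] at h
    have h' := (trans_cast_cast (k (A.vtx i c)) (A.edgeClass c i j) rfl (congrArg _ e0)
      (congrArg _ e1)).symm.trans h
    have := congrArg (fun ε => ε.cast rfl (congrArg _ e1.symm)) h'
    simpa using this
  -- This class is idempotent in a groupoid, hence trivial.
  have hself : ∀ i, A.edgeClass c i i = Path.Homotopic.Quotient.refl _ := fun i =>
    trans_left_cancel (A.edgeClass c i i) (by
      rw [A.edgeClass_trans, Path.Homotopic.Quotient.trans_refl])
  rcases lt_trichotomy i j with h | rfl | h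
  · exact hlt i j h
  · rw [hself, Path.Homotopic.Quotient.trans_refl]
  · rw [← hlt j i h, Path.Homotopic.Quotient.trans_assoc, A.edgeClass_trans, hself,
      Path.Homotopic.Quotient.trans_refl]

/-- Changing the vertex inserts an edge, which `k` absorbs. This independence is what lets the
classes agree on common faces. -/
theorem FaceAction.throughVertex_eq
    (hk : ∀ c : X 1, (k (A.vtx 0 c)).trans (A.edgeClass c 0 1) = k (A.vtx 1 c))
    {n : ℕ} (c : X n) (i j : Fin (n + 1)) (s : stdSimplex ℝ (Fin (n + 1))) :
    A.throughVertex k c i s = A.throughVertex k c j s := by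
  unfold FaceAction.throughVertex
  rw [← A.trans_edgeClass k hk c i j, Path.Homotopic.Quotient.trans_assoc]
  unfold FaceAction.edgeClass
  rw [trans_cast_cast, Realization.simplexClass_trans]

theorem FaceAction.throughVertex_face
    (hk : ∀ c : X 1, (k (A.vtx 0 c)).trans (A.edgeClass c 0 1) = k (A.vtx 1 c))
    {n : ℕ} (i : Fin (n + 2)) (c : X (n + 1)) (s : stdSimplex ℝ (Fin (n + 1))) :
    A.throughVertex k (d n i c) 0 s =
      (A.throughVertex k c 0 (stdSimplex.map i.succAbove s)).cast rfl (Realization.mk_face i c s) := by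
  -- Vertex `0` of the `i`-th face is vertex `i.succAbove 0` of `c`, which is not vertex `0` when `i
  -- = 0`.
  rw [A.throughVertex_eq k hk c 0 (i.succAboveOrderEmb 0)]
  have key : ∀ (b : X n) (hb : b = A.res i.succAboveOrderEmb c)
      (e : Realization.mk d b s = Realization.mk d c (stdSimplex.map i.succAbove s)),
      A.throughVertex k b 0 s = (A.throughVertex k c (i.succAboveOrderEmb 0)
        (stdSimplex.map i.succAbove s)).cast rfl e := by
    rintro _ rfl e
    have h : ∀ (a a' : stdSimplex ℝ (Fin (n + 2))) (t : stdSimplex ℝ (Fin (n + 2))) (ha : a = a'),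
        Realization.simplexClass d c a t = (Realization.simplexClass d c a' t).cast
          (congrArg _ ha) rfl := by
      rintro a _ t rfl
      simp
    unfold FaceAction.throughVertex
    rw [family_eq_cast k (A.vtx_res i.succAboveOrderEmb 0 c), A.simplexClass_res,
      h _ _ _ (stdSimplex.map_vertex i.succAboveOrderEmb 0), Path.Homotopic.Quotient.cast_cast,
      Path.Homotopic.Quotient.cast_cast, ← trans_cast_cast _ _ rfl
        (congrArg _ (A.vtx_res i.succAboveOrderEmb 0 c)) e, Path.Homotopic.Quotient.cast_cast]
    rfl
  exact key _ (A.res_succAbove i c).symm _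

/-- A realization is simply connected as soon as there are homotopy classes of paths from a fixed
point to all the vertices that are compatible with the edges. -/
theorem FaceAction.simplyConnectedSpace
    (hk : ∀ c : X 1, (k (A.vtx 0 c)).trans (A.edgeClass c 0 1) = k (A.vtx 1 c)) :
    SimplyConnectedSpace (Realization X d) := by
  let κ : ∀ x : Realization X d, Path.Homotopic.Quotient x₀ x := fun x =>
    Quot.rec (motive := fun x : Realization X d => Path.Homotopic.Quotient x₀ x)
      (fun z => A.throughVertex k z.1.2 0 z.2) (by
        rintro _ _ ⟨n, i, c, t⟩
        refine (eqRec_eq_cast (S := Realization X d) _ _).trans ?_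
        dsimp only
        rw [A.throughVertex_face k hk]
        exact (Path.Homotopic.Quotient.cast_cast _ _ _ _ _).trans
          (Path.Homotopic.Quotient.cast_rfl_rfl _)) x
  have hκ : ∀ {n : ℕ} (c : X n) (s t : stdSimplex ℝ (Fin (n + 1))),
      (κ (Realization.mk d c s)).trans (Realization.simplexClass d c s t) =
        κ (Realization.mk d c t) := fun c s t => A.throughVertex_trans k c 0 s t
  have hall : ∀ {x y : Realization X d} (γ : Path x y),
      (κ x).trans (Path.Homotopic.Quotient.mk γ) = κ y := by
    refine trans_eq_of_locally κ fun x => ?_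
    obtain ⟨n, c, t, ht, rfl⟩ := Realization.exists_mk_eq x
    obtain ⟨δ, hδ, hδt⟩ := exists_lt_forall_coord t ht
    obtain ⟨H, hH, hH'⟩ := FaceAction.exists_contraction (A := A) (c := c) hδ t
    have ht0 : A.Near c δ ⟨⟨n, c⟩, t⟩ (RelEmbedding.refl _) := FaceAction.near_self t hδt
    refine ⟨A.star c hδ, (FaceAction.isOpen_star hδ).mem_nhds ⟨_, ht0⟩, fun y γ hγ => ?_⟩
    have hy : y ∈ A.star c hδ := γ.target ▸ hγ 1
    obtain ⟨n', c', s, rfl⟩ : ∃ (n' : ℕ) (c' : X n') (s : stdSimplex ℝ (Fin (n' + 1))),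
        Realization.mk d c' s = y := by
      obtain ⟨⟨⟨n', c'⟩, s⟩, hz⟩ := Quot.exists_rep y
      exact ⟨n', c', s, hz⟩
    obtain ⟨g, hg⟩ := hy
    have hc : Realization.mk d c t = Realization.mk d c' (stdSimplex.map g t) := by
      rw [← A.mk_res g c' t, hg.res_eq]
    let F : C(I × I, Realization X d) := ContinuousMap.uncurry
      ⟨fun r => H (γ r), hH.comp_continuous γ.continuous hγ⟩
    have hend : ∀ z ∈ A.star c hδ, H z 0 = z ∧ H z 1 = Realization.mk d c t := by
      intro z hz
      obtain ⟨⟨⟨n', c'⟩, s⟩, rfl⟩ := Quot.exists_rep z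
      obtain ⟨g, hg⟩ := hz
      refine ⟨(hH' n' c' s g hg 0).trans ?_, (hH' n' c' s g hg 1).trans ?_⟩
      · rw [simplexSegment_zero]
        rfl
      · rw [simplexSegment_one, ← A.mk_res g c' t, hg.res_eq]
    let ε : Path s (stdSimplex.map g t) :=
      ⟨⟨fun r => simplexSegment (r, s, stdSimplex.map g t),
        continuous_simplexSegment.comp (by fun_prop)⟩, simplexSegment_zero _ _,
        simplexSegment_one _ _⟩
    -- Contracting the star along `γ` gives a square whose sides are `γ`, the segment `ε` back from
    -- its end, and two constant paths. Thus `γ` followed by `ε` is trivial, and compatibility with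
    -- `γ` reduces to that with `ε`, which lies in one simplex.
    have hsq := trans_eq_refl_of_square F γ.toContinuousMap (H (Realization.mk d c' s))
      (fun a => (hend _ (hγ a)).1)
      (fun b => congrArg (fun z => H z b) γ.target)
      (fun b => by
        change H (γ 0) b = _
        rw [γ.source, hH' n c t _ ht0 b]
        have : stdSimplex.map (RelEmbedding.refl (α := Fin (n + 1)) (· ≤ ·)) t = t :=
          stdSimplex.map_id_apply t
        rw [this, simplexSegment_self])
      (fun a => (hend _ (hγ a)).2) γ (fun _ => rfl)
      ((ε.map (Realization.continuous_mk c')).cast rfl hc)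
      (fun r => (hH' n' c' s g hg r).symm)
    have hback : (κ (Realization.mk d c' s)).trans (Path.Homotopic.Quotient.mk
        ((ε.map (Realization.continuous_mk c')).cast rfl hc)) = κ (Realization.mk d c t) := by
      rw [Path.Homotopic.Quotient.mk_cast, Realization.mk_map_eq, family_eq_cast κ hc,
        ← hκ c' s (stdSimplex.map g t)]
      have := trans_cast_cast (κ (Realization.mk d c' s))
        (Realization.simplexClass d c' s (stdSimplex.map g t)) rfl rfl hc
      rwa [Path.Homotopic.Quotient.cast_rfl_rfl] at this
    refine trans_right_cancel (Path.Homotopic.Quotient.mk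
      ((ε.map (Realization.continuous_mk c')).cast rfl hc)) ?_
    rw [hback, Path.Homotopic.Quotient.trans_assoc, hsq, Path.Homotopic.Quotient.trans_refl]
  have : Nonempty (Realization X d) := ⟨x₀⟩
  refine simply_connected_iff_paths_homotopic.2 ⟨?_, fun x y => ⟨fun γ γ' => ?_⟩⟩
  · exact ⟨‹_›, fun x y => ⟨((κ x).symm.trans (κ y)).out⟩⟩
  · induction γ using Path.Homotopic.Quotient.ind with | mk γ =>
    induction γ' using Path.Homotopic.Quotient.ind with | mk γ' =>
    exact trans_left_cancel (κ x) ((hall γ).trans (hall γ').symm)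

end Criterion

end SimplyConnected

end BoundQuiver

/-! ### Covering morphisms induce covering maps of classifying spaces. -/

namespace BoundQuiver

/-! ### Functors with unique lifts of morphisms -/

section UniqueLifts

universe v₁ v₂ u₁ u₂

variable {C : Type u₁} {D : Type u₂} [Category.{v₁} C] [Category.{v₂} D]

/-- At most one lift of a morphism with a given source. -/
def StarInjective (P : D ⥤ C) : Prop :=
  ∀ ⦃a b b' : D⦄ (f : a ⟶ b) (f' : a ⟶ b') (e : P.obj b = P.obj b'),
    P.map f ≫ eqToHom e = P.map f' → ∃ e' : b = b', f ≫ eqToHom e' = f'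

/-- At most one source for the lifts of a morphism with a given target. -/
def CostarInjective (P : D ⥤ C) : Prop :=
  ∀ ⦃a a' b : D⦄ (f : a ⟶ b) (f' : a' ⟶ b) (e : P.obj a' = P.obj a),
    eqToHom e ≫ P.map f = P.map f' → a = a'

/-- Every morphism has a lift with a given source. -/
def StarSurjective (P : D ⥤ C) : Prop :=
  ∀ ⦃a : D⦄ ⦃c : C⦄ (f : P.obj a ⟶ c), ∃ (b : D) (f' : a ⟶ b) (e : P.obj b = c),
    P.map f' ≫ eqToHom e = f

/-- Every morphism has a lift with a given target. -/
def CostarSurjective (P : D ⥤ C) : Prop :=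
  ∀ ⦃b : D⦄ ⦃c : C⦄ (f : c ⟶ P.obj b), ∃ (a : D) (f' : a ⟶ b) (e : c = P.obj a),
    eqToHom e ≫ P.map f' = f

variable {P : D ⥤ C}

theorem StarInjective.map_injective (hP : StarInjective P) {a b : D} {f f' : a ⟶ b}
    (h : P.map f = P.map f') : f = f' := by
  obtain ⟨e', he'⟩ := hP f f' rfl (by simpa using h)
  simpa using he'

/-- From the common object at `i`, uniqueness of sources brings the agreement back to `0`; unique
lifts from there propagate it to the whole chain. -/
theorem StarInjective.functor_ext (hP : StarInjective P) (hP' : CostarInjective P) {n : ℕ}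
    {F F' : Fin (n + 1) ⥤ D} (h : F ⋙ P = F' ⋙ P) (i : Fin (n + 1)) (hi : F.obj i = F'.obj i) :
    F = F' := by
  have hobj : ∀ j, P.obj (F.obj j) = P.obj (F'.obj j) := fun j => Functor.congr_obj h j
  have hmap : ∀ {j l : Fin (n + 1)} (g : j ⟶ l), P.map (F.map g) =
      eqToHom (hobj j) ≫ P.map (F'.map g) ≫ eqToHom (hobj l).symm := fun g =>
    Functor.congr_hom h g
  have hlift : ∀ {j l : Fin (n + 1)} (g : j ⟶ l) (hj : F.obj j = F'.obj j),
      ∃ e : F.obj l = F'.obj l, F.map g = eqToHom hj ≫ F'.map g ≫ eqToHom e.symm := by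
    intro j l g hj
    obtain ⟨e, he⟩ := hP (F.map g) (eqToHom hj ≫ F'.map g) (hobj l) (by
      rw [hmap, Functor.map_comp, eqToHom_map]
      simp)
    exact ⟨e, by rw [← Category.assoc, ← he]; simp⟩
  have hzero : F.obj 0 = F'.obj 0 := by
    refine hP' (F.map (homOfLE (Fin.zero_le i))) (F'.map (homOfLE (Fin.zero_le i)) ≫ eqToHom hi.symm)
      (hobj 0).symm ?_
    rw [hmap, Functor.map_comp, eqToHom_map]
    simp
  have hall : ∀ j, F.obj j = F'.obj j := fun j => (hlift (homOfLE (Fin.zero_le j)) hzero).1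
  exact CategoryTheory.Functor.ext hall fun j l g => (hlift g (hall j)).2

/-- It is enough to lift the morphisms from `0`; uniqueness then makes the lifts between later
objects fit together functorially. -/
theorem StarInjective.exists_functor (hP : StarInjective P) (hP' : StarSurjective P) {n : ℕ}
    (G : Fin (n + 1) ⥤ C) (a : D) (ha : P.obj a = G.obj 0) :
    ∃ F : Fin (n + 1) ⥤ D, F ⋙ P = G ∧ F.obj 0 = a := by
  choose b φ hb hφ using fun j => hP' (eqToHom ha ≫ G.map (homOfLE (Fin.zero_le j)))
  have hψ : ∀ {i j : Fin (n + 1)} (g : i ⟶ j), ∃ ψ : b i ⟶ b j,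
      P.map ψ = eqToHom (hb i) ≫ G.map g ≫ eqToHom (hb j).symm := by
    intro i j g
    obtain ⟨b', ψ, e, hψ⟩ := hP' (eqToHom (hb i) ≫ G.map g)
    have hg : homOfLE (Fin.zero_le i) ≫ g = homOfLE (Fin.zero_le j) := Subsingleton.elim _ _
    -- A lift of `g` from `b i` could end elsewhere; but after `φ i` it lifts the same morphism as
    -- `φ j`, so it ends at `b j`.
    obtain ⟨rfl, -⟩ := hP (φ i ≫ ψ) (φ j) (e.trans (hb j).symm) (by
      have h1 : P.map (φ i) = (eqToHom ha ≫ G.map (homOfLE (Fin.zero_le i))) ≫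
          eqToHom (hb i).symm := by
        rw [← hφ i]
        simp
      have h2 : P.map ψ = (eqToHom (hb i) ≫ G.map g) ≫ eqToHom e.symm := by
        rw [← hψ]
        simp
      have h3 : P.map (φ j) = (eqToHom ha ≫ G.map (homOfLE (Fin.zero_le j))) ≫
          eqToHom (hb j).symm := by
        rw [← hφ j]
        simp
      rw [P.map_comp, h1, h2, h3, ← hg, G.map_comp]
      simp)
    refine ⟨ψ, ?_⟩
    rw [← Category.assoc, ← hψ]
    simp
  choose ψ hψ using @hψ
  let F : Fin (n + 1) ⥤ D :=
    { obj := b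
      map := ψ
      map_id := fun i => hP.map_injective (by rw [hψ]; simp)
      map_comp := fun f g => hP.map_injective (by rw [P.map_comp, hψ, hψ, hψ]; simp) }
  refine ⟨F, CategoryTheory.Functor.ext hb fun i j g => hψ g, ?_⟩
  refine (hP (𝟙 a) (φ 0) (ha.trans (hb 0).symm) ?_).1.symm
  have h1 : P.map (φ 0) = (eqToHom ha ≫ G.map (homOfLE (Fin.zero_le 0))) ≫ eqToHom (hb 0).symm := by
    rw [← hφ 0]
    simp
  have h2 : G.map (homOfLE (Fin.zero_le (0 : Fin (n + 1)))) = 𝟙 _ := G.map_id 0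
  rw [h1, h2]
  simp

theorem StarInjective.exists_functor_at (hP : StarInjective P) (hP' : StarSurjective P)
    (hP'' : CostarSurjective P) {n : ℕ} (G : Fin (n + 1) ⥤ C) (i : Fin (n + 1)) (a : D)
    (ha : P.obj a = G.obj i) : ∃ F : Fin (n + 1) ⥤ D, F ⋙ P = G ∧ F.obj i = a := by
  obtain ⟨a₀, f, e, hf⟩ := hP'' (G.map (homOfLE (Fin.zero_le i)) ≫ eqToHom ha.symm)
  obtain ⟨F, rfl, rfl⟩ := hP.exists_functor hP' G a₀ e.symm
  refine ⟨F, rfl, ?_⟩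
  refine (hP (F.map (homOfLE (Fin.zero_le i))) f ha.symm ?_).1
  simpa using hf.symm

end UniqueLifts

/-! ### Lifting of paths and of homotopies along covering morphisms -/

section PathLifting

variable {k : Type w} [Field k] {W V : Type u} [Quiver.{u} W] [Quiver.{u} V]
  {J : PathIdeal k W} {I : PathIdeal k V} {p : W ⥤q V}

/-- The natural homotopy class of a path. -/
def PathIdeal.cls (I : PathIdeal k V) {x y : V} (a : Quiver.Path x y) :
    (⟨x⟩ : I.HomotopyCat) ⟶ ⟨y⟩ :=
  I.toHomotopyCat.map (X := x) (Y := y) a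

theorem PathIdeal.cls_comp {x y z : V} (a : Quiver.Path x y) (b : Quiver.Path y z) :
    I.cls (a.comp b) = I.cls a ≫ I.cls b :=
  I.toHomotopyCat.map_comp (X := x) (Y := y) (Z := z) a b

theorem PathIdeal.exists_cls_eq {x y : V} (f : (⟨x⟩ : I.HomotopyCat) ⟶ ⟨y⟩) :
    ∃ a : Quiver.Path x y, I.cls a = f :=
  Quot.exists_rep f

theorem PathIdeal.cls_eq_of_minimalRel {x y : V} {a b : Quiver.Path x y}
    (h : I.minimalRel (X := x) (Y := y) a b) : I.cls a = I.cls b := by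
  have h' := CategoryTheory.Quotient.sound I.minimalRel h
  exact h'

theorem exists_lift_path_of_star (hp : p.IsCovering) {x : W} {z : V} (b : Quiver.Path (p.obj x) z) :
    ∃ (y : W) (hy : p.obj y = z) (a : Quiver.Path x y), hy ▸ p.mapPath a = b := by
  obtain ⟨⟨y, a⟩, h⟩ := p.pathStar_surjective (fun u => (hp.star_bijective u).2) x ⟨z, b⟩
  cases h
  exact ⟨y, rfl, a, rfl⟩

theorem exists_lift_path_of_costar (hp : p.IsCovering) {v z : V} (b : Quiver.Path v z) :
    ∀ (y : W), p.obj y = z → ∃ (x : W) (a : Quiver.Path x y),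
      (⟨(v, z), b⟩ : Σ q : V × V, Quiver.Path q.1 q.2) = ⟨(p.obj x, p.obj y), p.mapPath a⟩ := by
  induction b with
  | nil =>
    rintro y rfl
    exact ⟨y, Quiver.Path.nil, rfl⟩
  | @cons m z b e ih =>
    rintro y rfl
    obtain ⟨⟨m', e'⟩, he⟩ := (hp.costar_bijective y).2 ⟨m, e⟩
    cases he
    obtain ⟨x, a, h⟩ := ih m' rfl
    refine ⟨x, a.cons e', ?_⟩
    cases h
    rfl

theorem pathCostar_injective (hp : p.IsCovering) {x y : W} (a : Quiver.Path x y) :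
    ∀ {x' : W} (a' : Quiver.Path x' y), (⟨p.obj x, p.mapPath a⟩ :
      Σ v : V, Quiver.Path v (p.obj y)) = ⟨p.obj x', p.mapPath a'⟩ → x = x' := by
  induction a with
  | nil =>
    intro x' a' h
    cases a' with
    | nil => rfl
    | cons a' e =>
      have := congrArg (fun s => s.2.length) h
      simp at this
  | @cons m y a e ih =>
    intro x' a' h
    cases a' with
    | nil =>
      have := congrArg (fun s => s.2.length) h
      simp at this
    | @cons m' _ a' e' =>
      have key : ∀ {v v' l l' z : V} (b : Quiver.Path v l) (f : l ⟶ z) (b' : Quiver.Path v' l')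
          (f' : l' ⟶ z), (⟨v, b.cons f⟩ : Σ v, Quiver.Path v z) = ⟨v', b'.cons f'⟩ →
          (⟨l, f⟩ : Quiver.Costar z) = ⟨l', f'⟩ ∧
          (⟨(v, l), b⟩ : Σ q : V × V, Quiver.Path q.1 q.2) = ⟨(v', l'), b'⟩ := by
        intro v v' l l' z b f b' f' hb
        cases hb
        exact ⟨rfl, rfl⟩
      obtain ⟨h1, h2⟩ := key _ _ _ _ h
      have h3 := (hp.costar_bijective y).1 (a₁ := ⟨m, e⟩) (a₂ := ⟨m', e'⟩) h1
      cases h3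
      refine ih a' ?_
      have key2 : ∀ {v v' l : V} (b : Quiver.Path v l) (b' : Quiver.Path v' l),
          (⟨(v, l), b⟩ : Σ q : V × V, Quiver.Path q.1 q.2) = ⟨(v', l), b'⟩ →
          (⟨v, b⟩ : Σ v, Quiver.Path v l) = ⟨v', b'⟩ := by
        intro v v' l b b' hb
        cases hb
        rfl
      exact key2 _ _ h2

theorem pathStar_ext (hp : p.IsCovering) {x y y' : W} (a : Quiver.Path x y) (a' : Quiver.Path x y')
    (h : (⟨p.obj y, p.mapPath a⟩ : Quiver.PathStar (p.obj x)) = ⟨p.obj y', p.mapPath a'⟩) :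
    (⟨y, a⟩ : Quiver.PathStar x) = ⟨y', a'⟩ :=
  p.pathStar_injective (fun u => (hp.star_bijective u).1) x (a₁ := ⟨y, a⟩) (a₂ := ⟨y', a'⟩) h

theorem comp_eqToHom_sigma {C : Type*} [Category C] {a b c : C} (f : a ⟶ b) (e : b = c)
    (f' : a ⟶ c) (h : f ≫ eqToHom e = f') : (⟨b, f⟩ : Σ c, a ⟶ c) = ⟨c, f'⟩ := by
  subst e h
  simp

theorem starInjective_pathFunctor (hp : p.IsCovering) : StarInjective (pathFunctor p) := by
  intro x y y' a a' e h
  have := pathStar_ext hp (x := x) (y := y) (y' := y') a a' (comp_eqToHom_sigma _ e _ h)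
  cases this
  exact ⟨rfl, Category.comp_id _⟩

theorem starSurjective_pathFunctor (hp : p.IsCovering) : StarSurjective (pathFunctor p) := by
  intro x z b
  obtain ⟨y, rfl, a, rfl⟩ := exists_lift_path_of_star hp (x := x) (z := z) b
  exact ⟨y, a, rfl, Category.comp_id _⟩

theorem costarSurjective_pathFunctor (hp : p.IsCovering) : CostarSurjective (pathFunctor p) := by
  intro y v b
  obtain ⟨x, a, h⟩ := exists_lift_path_of_costar hp (v := v) b y rfl
  cases h
  exact ⟨x, a, rfl, Category.id_comp _⟩

/-- Since `p` is injective on parallel paths, partial sums of `ρ` in `J` become partial sums of its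
image in `I`, which are trivial. -/
theorem IsCoveringMorphism.isMinimalRelation_of_pushforward (h : IsCoveringMorphism J I p) {x y : W}
    {ρ : Quiver.Path x y →₀ k} (hJ : ρ ∈ J.carrier x y)
    (hρ : I.IsMinimalRelation (pushforward p ρ)) : J.IsMinimalRelation ρ := by
  classical
  have hinj := h.mapPath_injective x y
  have hinj' := Finsupp.mapDomain_injective (M := k) hinj
  refine ⟨⟨hJ, ?_, fun S hS => ?_⟩, ?_⟩
  · rintro rfl
    exact hρ.1.ne_zero (by simp [pushforward])
  · have e := h.filter_pushforward ρ (p.mapPath '' S)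
    rw [Set.preimage_image_eq _ hinj] at e
    rcases hρ.1.partial_sum (p.mapPath '' S) (e ▸ h.map_mem _ hS) with h1 | h1
    · left
      rw [e] at h1
      exact hinj' (by simpa [pushforward] using h1)
    · right
      rw [e] at h1
      exact hinj' h1
  · have := hρ.2
    rwa [pushforward, Finsupp.mapDomain_support_of_injective hinj,
      Finset.card_image_of_injective _ hinj] at this

/-- A path homotopic to the image of a path `a` is the image of a path homotopic to `a`. -/
theorem IsCoveringMorphism.lift_homotopic (h : IsCoveringMorphism J I p) {x y : W}
    (a : Quiver.Path x y) (b : Quiver.Path (p.obj x) (p.obj y))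
    (hb : I.cls (p.mapPath a) =
      I.cls b) :
    ∃ a' : Quiver.Path x y, p.mapPath a' = b ∧
      J.cls a = J.cls a' := by
  have hstep : ∀ b₁ b₂ : Quiver.Path (p.obj x) (p.obj y),
      HomRel.CompClosure I.minimalRel (X := (p.obj x : V)) (Y := (p.obj y : V)) b₁ b₂ →
      ∀ a₁ : Quiver.Path x y, p.mapPath a₁ = b₁ → ∃ a₂ : Quiver.Path x y, p.mapPath a₂ = b₂ ∧
        J.cls a₁ = J.cls a₂ := by
    classical
    have hinj := h.mapPath_injective
    rintro _ _ ⟨(m : V), (m' : V), (f : Quiver.Path _ _), (m₁ : Quiver.Path _ _),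
      (m₂ : Quiver.Path _ _), (g : Quiver.Path _ _), ρ, hρ, h1, h2⟩ a₁ ha₁
    -- Lift `f` from `x`, then the whole relation from the end of that lift. Both middle paths now
    -- end at the same vertex `y₁`, so a single lift of `g` completes them both, and unique path
    -- lifting identifies the first completion with `a₁`.
    obtain ⟨x₁, rfl, f, rfl⟩ := exists_lift_path_of_star h.covering f
    obtain ⟨y₁, rfl, ρ, hρJ, rfl⟩ := h.lift x₁ m' ρ hρ.1
    obtain ⟨m₁, h1', rfl⟩ := Finset.mem_image.1 (Finsupp.mapDomain_support h1)
    obtain ⟨m₂, h2', rfl⟩ := Finset.mem_image.1 (Finsupp.mapDomain_support h2)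
    clear h1 h2
    obtain ⟨⟨y₂, g'⟩, hg⟩ := p.pathStar_surjective (fun u => (h.covering.star_bijective u).2) y₁
      ⟨p.obj y, g⟩
    have e := pathStar_ext h.covering (f.comp (m₁.comp g')) a₁ (by
      rw [ha₁, Prefunctor.mapPath_comp, Prefunctor.mapPath_comp]
      exact congrArg (fun s : Quiver.PathStar (p.obj y₁) =>
        (⟨s.1, (p.mapPath f).comp ((p.mapPath m₁).comp s.2)⟩ : Quiver.PathStar (p.obj x))) hg)
    cases e
    cases hg
    refine ⟨f.comp (m₂.comp g'), by rw [Prefunctor.mapPath_comp, Prefunctor.mapPath_comp]; rfl, ?_⟩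
    rw [PathIdeal.cls_comp, PathIdeal.cls_comp, PathIdeal.cls_comp, PathIdeal.cls_comp,
      PathIdeal.cls_eq_of_minimalRel ⟨ρ, h.isMinimalRelation_of_pushforward hρJ hρ, h1', h2'⟩]
  have hgen := (CategoryTheory.Quotient.functor_homRel_eq_compClosure_eqvGen I.minimalRel
    (X := (p.obj x : V)) (Y := (p.obj y : V)) (p.mapPath a) b).1 hb
  -- Both directions are carried through the induction, so that the symmetry case only swaps them.
  have key : ∀ b₁ b₂ : Quiver.Path (p.obj x) (p.obj y), Relation.EqvGen
      (@HomRel.CompClosure (Paths V) _ I.minimalRel (p.obj x : V) (p.obj y : V)) b₁ b₂ →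
      (∀ a₁ : Quiver.Path x y, p.mapPath a₁ = b₁ → ∃ a₂ : Quiver.Path x y, p.mapPath a₂ = b₂ ∧
        J.cls a₁ = J.cls a₂) ∧
      (∀ a₁ : Quiver.Path x y, p.mapPath a₁ = b₂ → ∃ a₂ : Quiver.Path x y, p.mapPath a₂ = b₁ ∧
        J.cls a₁ = J.cls a₂) := by
    intro b₁ b₂ hb
    induction hb with
    | rel b₁ b₂ hb =>
      refine ⟨hstep b₁ b₂ hb, hstep b₂ b₁ ?_⟩
      obtain ⟨m, m', f, m₁, m₂, g, ρ, hρ, h1, h2⟩ := hb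
      exact ⟨m, m', f, m₂, m₁, g, ρ, hρ, h2, h1⟩
    | refl b => exact ⟨fun a ha => ⟨a, ha, rfl⟩, fun a ha => ⟨a, ha, rfl⟩⟩
    | symm b₁ b₂ _ ih => exact ih.symm
    | trans b₁ b₂ b₃ _ _ ih1 ih2 =>
      constructor
      · intro a₁ ha₁
        obtain ⟨a₂, ha₂, e⟩ := ih1.1 a₁ ha₁
        obtain ⟨a₃, ha₃, e'⟩ := ih2.1 a₂ ha₂
        exact ⟨a₃, ha₃, e.trans e'⟩
      · intro a₁ ha₁
        obtain ⟨a₂, ha₂, e⟩ := ih2.2 a₁ ha₁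
        obtain ⟨a₃, ha₃, e'⟩ := ih1.2 a₂ ha₂
        exact ⟨a₃, ha₃, e.trans e'⟩
  exact (key _ _ hgen).1 a rfl

/-- If the images of two paths are homotopic, lifting that homotopy replaces the first path by a
homotopic one with the same image as the second; unique path lifting then makes these equal, ends
included. -/
theorem IsCoveringMorphism.starInjective_homotopyFunctor (h : IsCoveringMorphism J I p) :
    StarInjective h.homotopyFunctor := by
  rintro ⟨x : W⟩ ⟨y : W⟩ ⟨y' : W⟩ f f' e hf
  obtain ⟨a, rfl⟩ := PathIdeal.exists_cls_eq f
  obtain ⟨a', rfl⟩ := PathIdeal.exists_cls_eq f'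
  have key : ∀ (z : V) (b : Quiver.Path (p.obj x) z) (e : (⟨p.obj y⟩ : I.HomotopyCat) = ⟨z⟩),
      I.cls (p.mapPath a) ≫ eqToHom e =
        I.cls b →
      ∃ a'' : Quiver.Path x y, (⟨p.obj y, p.mapPath a''⟩ : Quiver.PathStar (p.obj x)) = ⟨z, b⟩ ∧
        J.cls a = J.cls a'' := by
    intro z b e hb
    obtain rfl : p.obj y = z := congrArg (fun c : I.HomotopyCat => (c.as : V)) e
    obtain ⟨a'', rfl, h2⟩ := h.lift_homotopic a b (by simpa using hb)
    exact ⟨a'', rfl, h2⟩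
  obtain ⟨a'', h1, h2⟩ := key (p.obj y') (p.mapPath a') e hf
  have := pathStar_ext h.covering a'' a' h1
  cases this
  exact ⟨rfl, by simpa using h2⟩

theorem IsCoveringMorphism.costarInjective_homotopyFunctor (h : IsCoveringMorphism J I p) :
    CostarInjective h.homotopyFunctor := by
  rintro ⟨x : W⟩ ⟨x' : W⟩ ⟨y : W⟩ f f' e hf
  obtain ⟨a, rfl⟩ := PathIdeal.exists_cls_eq f
  obtain ⟨a', rfl⟩ := PathIdeal.exists_cls_eq f'
  have key : ∀ (z : V) (b : Quiver.Path z (p.obj y)) (e : (⟨z⟩ : I.HomotopyCat) = ⟨p.obj x⟩),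
      eqToHom e ≫ I.cls (p.mapPath a) =
        I.cls b →
      ∃ a'' : Quiver.Path x y, (⟨p.obj x, p.mapPath a''⟩ :
        Σ v : V, Quiver.Path v (p.obj y)) = ⟨z, b⟩ := by
    intro z b e hb
    obtain rfl : z = p.obj x := congrArg (fun c : I.HomotopyCat => (c.as : V)) e
    obtain ⟨a'', rfl, h2⟩ := h.lift_homotopic a b (by simpa using hb)
    exact ⟨a'', rfl⟩
  obtain ⟨a'', h1⟩ := key (p.obj x') (p.mapPath a') e hf
  obtain rfl := pathCostar_injective h.covering a'' a' h1
  rfl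

end PathLifting

/-! ### The covering of classifying spaces -/

section CellCovering

variable {k : Type w} [Field k] {W V : Type u} [Quiver.{u} W] [Quiver.{u} V]
  {J : PathIdeal k W} {I : PathIdeal k V} {p : W ⥤q V}

theorem PathIdeal.IsNonzeroChain.res {m n : ℕ} {G : Fin (n + 1) ⥤ Paths V}
    (hG : I.IsNonzeroChain G) (f : Fin (m + 1) ↪o Fin (n + 1)) :
    I.IsNonzeroChain (f.monotone.functor ⋙ G) := by
  refine ⟨fun a b h => hG.pos _ _ (f.strictMono h), fun hz => hG.nonzero ?_⟩
  have e : (homOfLE (Fin.zero_le (Fin.last n)) : (0 : Fin (n + 1)) ⟶ Fin.last n) =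
      (homOfLE (Fin.zero_le (f 0)) ≫
        f.monotone.functor.map (homOfLE (Fin.zero_le (Fin.last m)))) ≫
        homOfLE (Fin.le_last (f (Fin.last m))) := Subsingleton.elim _ _
  have e' : G.map (homOfLE (Fin.zero_le (Fin.last n))) = _ :=
    (congrArg (fun f => G.map f) e).trans
      ((G.map_comp _ _).trans (congrArg (fun f => f ≫ _) (G.map_comp _ _)))
  rw [e']
  exact PathIdeal.IsZeroPath.comp (V := V) _ _ hz

/-- The iterated faces of the cells of the classifying space. -/
def PathIdeal.cellAction (I : PathIdeal k V) : FaceAction I.Cell I.face where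
  res f c := ⟨f.monotone.functor ⋙ c.1, by
    obtain ⟨G, hG, hc⟩ := c.2
    exact ⟨_, hG.res f, by rw [← hc]; rfl⟩⟩
  res_refl _ := rfl
  res_res _ _ _ := rfl
  res_succAbove _ _ := rfl

theorem PathIdeal.Cell.ext_zero {c c' : I.Cell 0} (h : c.1.obj 0 = c'.1.obj 0) : c = c' :=
  Subtype.ext (ComposableArrows.ext₀ h)

/-- Existence is obtained on representing chains of paths, where membership in the ideal is detected
by `p`; uniqueness needs homotopy classes, hence unique lifting for `homotopyFunctor`. -/
theorem IsCoveringMorphism.isCellCovering (h : IsCoveringMorphism J I p) :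
    IsCellCovering J.cellAction I.cellAction h.cellMap where
  map_res _ _ := rfl
  exists_lift := by
    rintro n i ⟨_, G, hG, rfl⟩ v hv
    have hv' : p.obj (v.1.obj 0).as = G.obj i := congrArg (fun c : I.Cell 0 => (c.1.obj 0).as) hv
    obtain ⟨F, rfl, hF⟩ := (starInjective_pathFunctor h.covering).exists_functor_at
      (starSurjective_pathFunctor h.covering) (costarSurjective_pathFunctor h.covering) G i
      (v.1.obj 0).as hv'
    refine ⟨⟨F ⋙ J.toHomotopyCat, F, ⟨fun a b hab => ?_, fun hz => ?_⟩, rfl⟩, rfl, ?_⟩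
    · have e : ∀ {x y : W} (a : Quiver.Path x y), (p.mapPath a).length = a.length := by
        intro x y a
        induction a with
        | nil => rfl
        | cons a e ih => simp [ih]
      exact lt_of_lt_of_eq (hG.pos a b hab) (e _)
    · exact hG.nonzero ((h.isZeroPath_iff _).2 hz)
    · refine PathIdeal.Cell.ext_zero ?_
      exact congrArg J.toHomotopyCat.obj hF
  eq_of_vtx := by
    intro n i c c' hc hv
    exact Subtype.ext ((h.starInjective_homotopyFunctor).functor_ext
      h.costarInjective_homotopyFunctor (congrArg Subtype.val hc) i
      (congrArg (fun b : J.Cell 0 => b.1.obj 0) hv))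

theorem IsCoveringMorphism.isCoveringMap_classifyingMap (h : IsCoveringMorphism J I p) :
    IsCoveringMap h.classifyingMap :=
  h.isCellCovering.isCoveringMap _

end CellCovering

end BoundQuiver

/-! ### Edge paths in the classifying space of an admissible bound quiver. -/

namespace BoundQuiver

/-! ### Paths in admissible bound quivers -/

section Admissible

variable {k : Type w} [Field k] {V : Type u} [Quiver.{v} V]

theorem mem_arrowIdealPow_iff {m : ℕ} {x y : V} {ρ : Quiver.Path x y →₀ k} :
    ρ ∈ arrowIdealPow k m x y ↔ ∀ a ∈ ρ.support, m ≤ a.length := by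
  classical
  constructor
  · intro h
    induction h using Submodule.span_induction with
    | mem ρ h =>
      obtain ⟨a, ha, rfl⟩ := h
      intro b hb
      obtain rfl : b = a := by simpa using Finsupp.support_single_subset hb
      exact ha
    | zero => simp
    | add ρ ρ' _ _ h h' =>
      intro a ha
      rcases Finset.mem_union.1 (Finsupp.support_add ha) with ha | ha
      · exact h a ha
      · exact h' a ha
    | smul t ρ _ h => exact fun a ha => h a (Finsupp.support_smul ha)
  · intro h
    rw [← Finsupp.sum_single ρ]
    refine Submodule.sum_mem _ fun a ha => ?_
    rw [show Finsupp.single a (ρ a) = ρ a • Finsupp.single a (1 : k) by simp]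
    exact Submodule.smul_mem _ _ (Submodule.subset_span ⟨a, h a ha, rfl⟩)

theorem PathIdeal.IsAdmissible.two_le_length {I : PathIdeal k V} (hI : I.IsAdmissible) {x y : V}
    {a : Quiver.Path x y} (ha : I.IsZeroPath a) : 2 ≤ a.length := by
  obtain ⟨m, -, h⟩ := hI
  exact mem_arrowIdealPow_iff.1 ((h x y).2 ha) a (by simp)

/-- Otherwise the single term at `a` would be a nonempty proper partial sum in the ideal. Hence
paths of minimal relations do define 1-cells. -/
theorem PathIdeal.IsMinimalRelation.not_isZeroPath {I : PathIdeal k V} {x y : V}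
    {ρ : Quiver.Path x y →₀ k} (hρ : I.IsMinimalRelation ρ) {a : Quiver.Path x y}
    (ha : a ∈ ρ.support) : ¬ I.IsZeroPath a := by
  classical
  intro hz
  have e : partialSum ρ {a} = ρ a • Finsupp.single a (1 : k) := by
    ext b
    by_cases h : b = a
    · subst h
      simp [partialSum]
    · simp [partialSum, h]
  have hs : (partialSum ρ {a}).support = {a} := by
    rw [e, Finsupp.smul_single_one]
    exact Finsupp.support_single _ (Finsupp.mem_support_iff.1 ha)
  rcases hρ.1.partial_sum {a} (e ▸ Submodule.smul_mem _ _ hz) with h | h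
  · rw [h] at hs
    simp at hs
  · have := hρ.2
    rw [← h, hs] at this
    simp at this

end Admissible

/-! ### Classes of edge paths in the classifying space -/

section EdgePaths

variable {k : Type w} [Field k] {V : Type u} [Quiver.{u} V] {I : PathIdeal k V}

/-- A nonstationary path that does not belong to the ideal. -/
structure PathIdeal.IsNonzeroPath (I : PathIdeal k V) {x y : V} (a : Quiver.Path x y) : Prop where
  pos : 0 < a.length
  nonzero : ¬ I.IsZeroPath a

theorem PathIdeal.Cell.ext_one {c c' : I.Cell 1} (h0 : c.1.obj 0 = c'.1.obj 0)
    (h1 : c.1.obj 1 = c'.1.obj 1)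
    (h : c.1.map (homOfLE (Fin.zero_le 1)) =
      eqToHom h0 ≫ c'.1.map (homOfLE (Fin.zero_le 1)) ≫ eqToHom h1.symm) : c = c' :=
  Subtype.ext (ComposableArrows.ext₁ h0 h1 h)

/-- Puts an equality that holds by definition into the shape required by `PathIdeal.Cell.ext_one`.
-/
theorem eq_eqToHom_conj {C : Type*} [Category C] {a b : C} (f : a ⟶ b) (h : a = a) (h' : b = b) :
    f = eqToHom h ≫ f ≫ eqToHom h' := by
  simp

/-- The `0`-cell of a vertex. -/
def PathIdeal.IsAdmissible.vertexCell (hI : I.IsAdmissible) (x : V) : I.Cell 0 :=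
  ⟨ComposableArrows.mk₀ (C := Paths V) x ⋙ I.toHomotopyCat, ComposableArrows.mk₀ (C := Paths V) x,
    ⟨fun i j h => absurd h (by omega), fun hz => absurd (hI.two_le_length (x := x) (y := x) hz)
      (Nat.not_le.2 (show Quiver.Path.length (Quiver.Path.nil (a := x)) < 2 by simp))⟩, rfl⟩

/-- The `1`-cell of a path. -/
def PathIdeal.IsNonzeroPath.cell {x y : V} {a : Quiver.Path x y} (ha : I.IsNonzeroPath a) :
    I.Cell 1 :=
  ⟨ComposableArrows.mk₁ (C := Paths V) (X₀ := x) (X₁ := y) a ⋙ I.toHomotopyCat,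
    ComposableArrows.mk₁ (C := Paths V) (X₀ := x) (X₁ := y) a, ⟨fun i j h => by
      obtain ⟨rfl, rfl⟩ := (by decide : ∀ i j : Fin 2, i < j → i = 0 ∧ j = 1) i j h
      exact ha.pos, ha.nonzero⟩, rfl⟩

/-- The `2`-cell of two consecutive paths. -/
def PathIdeal.IsNonzeroPath.cell₂ {x y z : V} {a : Quiver.Path x y} {b : Quiver.Path y z}
    (ha : I.IsNonzeroPath a) (hb : I.IsNonzeroPath b) (hab : I.IsNonzeroPath (a.comp b)) :
    I.Cell 2 :=
  ⟨ComposableArrows.mk₂ (C := Paths V) (X₀ := x) (X₁ := y) (X₂ := z) a b ⋙ I.toHomotopyCat,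
    ComposableArrows.mk₂ (C := Paths V) (X₀ := x) (X₁ := y) (X₂ := z) a b, ⟨fun i j h => by
      obtain ⟨rfl, rfl⟩ | ⟨rfl, rfl⟩ | ⟨rfl, rfl⟩ := (by decide : ∀ i j : Fin 3, i < j →
        i = 0 ∧ j = 1 ∨ i = 1 ∧ j = 2 ∨ i = 0 ∧ j = 2) i j h
      · exact ha.pos
      · exact hb.pos
      · exact hab.pos, hab.nonzero⟩, rfl⟩

theorem PathIdeal.Cell.exists_eq_cell (c : I.Cell 1) :
    ∃ (x y : V) (a : Quiver.Path x y) (ha : I.IsNonzeroPath a), c = ha.cell := by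
  obtain ⟨_, G, hG, rfl⟩ := c
  refine ⟨G.obj 0, G.obj 1, G.map (homOfLE (Fin.zero_le 1)), ⟨hG.pos 0 1 (by simp), hG.nonzero⟩, ?_⟩
  exact PathIdeal.Cell.ext_one rfl rfl (eq_eqToHom_conj _ rfl rfl)

theorem PathIdeal.IsNonzeroPath.cell_eq_cell {x y : V} {a b : Quiver.Path x y}
    (ha : I.IsNonzeroPath a) (hb : I.IsNonzeroPath b) (h : I.cls a = I.cls b) : ha.cell = hb.cell := by
  exact PathIdeal.Cell.ext_one rfl rfl (h.trans (eq_eqToHom_conj _ rfl rfl))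

/-- The point of the classifying space given by a vertex. -/
noncomputable abbrev PathIdeal.IsAdmissible.point (hI : I.IsAdmissible) (x : V) :
    ClassifyingSpace I :=
  Realization.pt I.face (hI.vertexCell x)

theorem PathIdeal.IsAdmissible.point_eq (hI : I.IsAdmissible) {n : ℕ} {c : I.Cell n} {i : Fin (n + 1)} {x : V}
    (h : c.1.obj i = ⟨x⟩) : hI.point x = Realization.pt I.face (I.cellAction.vtx i c) :=
  congrArg _ (PathIdeal.Cell.ext_zero h.symm)

/-- The class of the edge given by a path. -/
noncomputable def PathIdeal.IsAdmissible.edge (hI : I.IsAdmissible) {x y : V} {a : Quiver.Path x y}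
    (ha : I.IsNonzeroPath a) : Path.Homotopic.Quotient (hI.point x) (hI.point y) :=
  (I.cellAction.edgeClass ha.cell 0 1).cast (hI.point_eq rfl) (hI.point_eq rfl)

theorem PathIdeal.IsAdmissible.edge_eq_of_cell (hI : I.IsAdmissible) {x y : V} {a : Quiver.Path x y}
    (ha : I.IsNonzeroPath a) {c : I.Cell 1} (hc : c = ha.cell)
    (hx : hI.point x = Realization.pt I.face (I.cellAction.vtx 0 c))
    (hy : hI.point y = Realization.pt I.face (I.cellAction.vtx 1 c)) :
    hI.edge ha = (I.cellAction.edgeClass c 0 1).cast hx hy := by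
  subst hc
  rfl

theorem PathIdeal.IsAdmissible.edge_congr (hI : I.IsAdmissible) {x y : V} {a b : Quiver.Path x y}
    (ha : I.IsNonzeroPath a) (hb : I.IsNonzeroPath b) (h : I.cls a = I.cls b) :
    hI.edge ha = hI.edge hb :=
  hI.edge_eq_of_cell ha (ha.cell_eq_cell hb h).symm _ _

theorem PathIdeal.IsAdmissible.edge_eq_edgeClass (hI : I.IsAdmissible) {x y : V} {a : Quiver.Path x y}
    (ha : I.IsNonzeroPath a) {n : ℕ} (c : I.Cell n) {i j : Fin (n + 1)} (hij : i < j)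
    (h : I.cellAction.res (edgeEmb hij) c = ha.cell)
    (hx : c.1.obj i = ⟨x⟩) (hy : c.1.obj j = ⟨y⟩) :
    hI.edge ha = (I.cellAction.edgeClass c i j).cast (hI.point_eq hx) (hI.point_eq hy) := by
  rw [hI.edge_eq_of_cell ha h (hI.point_eq hx) (hI.point_eq hy), FaceAction.edgeClass_res]
  exact Path.Homotopic.Quotient.cast_cast _ _ _ _ _

/-- The three edges bound the triangle of the 2-cell of `a` and `b`. -/
theorem PathIdeal.IsAdmissible.edge_comp (hI : I.IsAdmissible) {x y z : V} {a : Quiver.Path x y} {b : Quiver.Path y z}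
    (ha : I.IsNonzeroPath a) (hb : I.IsNonzeroPath b) (hab : I.IsNonzeroPath (a.comp b)) :
    hI.edge hab = (hI.edge ha).trans (hI.edge hb) := by
  have e1 : I.cellAction.res (edgeEmb (show (0 : Fin 3) < 1 by decide)) (ha.cell₂ hb hab) =
      ha.cell := by
    exact PathIdeal.Cell.ext_one rfl rfl (eq_eqToHom_conj _ rfl rfl)
  have e2 : I.cellAction.res (edgeEmb (show (1 : Fin 3) < 2 by decide)) (ha.cell₂ hb hab) =
      hb.cell := by
    exact PathIdeal.Cell.ext_one rfl rfl (eq_eqToHom_conj _ rfl rfl)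
  have e3 : I.cellAction.res (edgeEmb (show (0 : Fin 3) < 2 by decide)) (ha.cell₂ hb hab) =
      hab.cell := by
    exact PathIdeal.Cell.ext_one rfl rfl (eq_eqToHom_conj _ rfl rfl)
  rw [hI.edge_eq_edgeClass ha _ _ e1 rfl rfl, hI.edge_eq_edgeClass hb _ _ e2 rfl rfl,
    hI.edge_eq_edgeClass hab _ _ e3 rfl rfl, trans_cast_cast, FaceAction.edgeClass_trans]

theorem PathIdeal.IsAdmissible.isNonzeroPath_arrow (hI : I.IsAdmissible) {x y : V} (e : x ⟶ y) :
    I.IsNonzeroPath e.toPath :=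
  ⟨by simp, fun h => absurd (hI.two_le_length h) (by simp)⟩

/-- The class of the edge given by an arrow. -/
noncomputable def PathIdeal.IsAdmissible.arrow (hI : I.IsAdmissible) {x y : V} (e : x ⟶ y) :
    Path.Homotopic.Quotient (hI.point x) (hI.point y) :=
  hI.edge (hI.isNonzeroPath_arrow e)

/-- The class of the edge path given by a path. -/
noncomputable def PathIdeal.IsAdmissible.edgePath (hI : I.IsAdmissible) {x : V} : ∀ {y : V} (_ : Quiver.Path x y),
    Path.Homotopic.Quotient (hI.point x) (hI.point y)
  | _, .nil => Path.Homotopic.Quotient.refl _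
  | _, .cons a e => (PathIdeal.IsAdmissible.edgePath hI a).trans (hI.arrow e)

/-- Every nonstationary initial piece of a nonzero path is nonzero, so 2-cells split off the last
arrow repeatedly. -/
theorem PathIdeal.IsAdmissible.edge_eq_edgePath (hI : I.IsAdmissible) {x y : V} {a : Quiver.Path x y}
    (ha : I.IsNonzeroPath a) : hI.edge ha = hI.edgePath a := by
  induction a with
  | nil => exact absurd ha.pos (by simp)
  | @cons y z a e ih =>
    by_cases h0 : a.length = 0
    · obtain rfl := Quiver.Path.eq_of_length_zero a h0
      obtain rfl := Quiver.Path.eq_nil_of_length_zero a h0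
      exact (Path.Homotopic.Quotient.refl_trans _).symm
    · have ha' : I.IsNonzeroPath a := by
        refine ⟨Nat.pos_of_ne_zero h0, fun hz => ha.nonzero ?_⟩
        have := PathIdeal.IsZeroPath.comp Quiver.Path.nil e.toPath hz
        rwa [Quiver.Path.nil_comp] at this
      exact (hI.edge_comp ha' (hI.isNonzeroPath_arrow e) ha).trans
        (congrArg (fun t => t.trans (hI.arrow e)) (ih ha'))

/-- Both paths are nonzero and naturally homotopic, so they give literally the same 1-cell.
Relations therefore hold in the fundamental groupoid. -/
theorem PathIdeal.IsAdmissible.edgePath_eq_of_isMinimalRelation (hI : I.IsAdmissible) {x y : V}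
    {ρ : Quiver.Path x y →₀ k} (hρ : I.IsMinimalRelation ρ) {a b : Quiver.Path x y}
    (ha : a ∈ ρ.support) (hb : b ∈ ρ.support) : hI.edgePath a = hI.edgePath b := by
  have hnz : ∀ a ∈ ρ.support, I.IsNonzeroPath a := fun a ha => by
    refine ⟨?_, hρ.not_isZeroPath ha⟩
    obtain ⟨m, -, h⟩ := hI
    have := mem_arrowIdealPow_iff.1 ((h x y).2 hρ.1.mem) a ha
    omega
  rw [← hI.edge_eq_edgePath (hnz a ha), ← hI.edge_eq_edgePath (hnz b hb)]
  exact hI.edge_congr _ _ (PathIdeal.cls_eq_of_minimalRel ⟨ρ, hρ, ha, hb⟩)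

/-- The classifying space is simply connected if its edge paths from a base point can be
given compatible classes. -/
theorem PathIdeal.IsAdmissible.simplyConnectedSpace (hI : I.IsAdmissible) {x₀ : ClassifyingSpace I}
    (κ : ∀ x : V, Path.Homotopic.Quotient x₀ (hI.point x))
    (hκ : ∀ {x y : V} (e : x ⟶ y), (κ x).trans (hI.arrow e) = κ y) :
    SimplyConnectedSpace (ClassifyingSpace I) := by
  have hpath : ∀ {x y : V} (a : Quiver.Path x y), (κ x).trans (hI.edgePath a) = κ y := by
    intro x y a
    induction a with
    | nil => exact Path.Homotopic.Quotient.trans_refl _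
    | cons a e ih =>
      rw [PathIdeal.IsAdmissible.edgePath, ← Path.Homotopic.Quotient.trans_assoc, ih, hκ]
  have hpt : ∀ v : I.Cell 0, Realization.pt I.face v = hI.point (v.1.obj 0).as := fun v =>
    congrArg _ (PathIdeal.Cell.ext_zero rfl)
  let κ' : ∀ v : I.Cell 0, Path.Homotopic.Quotient x₀ (Realization.pt I.face v) := fun v =>
    (κ (v.1.obj 0).as).cast rfl (hpt v)
  refine I.cellAction.simplyConnectedSpace κ' fun c => ?_
  obtain ⟨x, y, a, ha, rfl⟩ := c.exists_eq_cell
  have h1 := hpath a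
  rw [← hI.edge_eq_edgePath ha] at h1
  have h2 := trans_cast_cast (κ x) (hI.edge ha) rfl (hpt (I.cellAction.vtx 0 ha.cell))
    (hpt (I.cellAction.vtx 1 ha.cell))
  rw [h1] at h2
  refine Eq.trans ?_ h2
  refine congrArg (fun t => (κ' _).trans t) ?_
  unfold PathIdeal.IsAdmissible.edge
  exact ((Path.Homotopic.Quotient.cast_cast _ _ _ _ _).trans
    (Path.Homotopic.Quotient.cast_rfl_rfl _)).symm

end EdgePaths

end BoundQuiver

/-! ### The fundamental cover and simple connectivity of the universal cover. -/

namespace BoundQuiver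

/-! ### Edge paths and covering morphisms -/

section Functoriality

variable {k : Type w} [Field k] {W V : Type u} [Quiver.{u} W] [Quiver.{u} V]
  {J : PathIdeal k W} {I : PathIdeal k V} {p : W ⥤q V}

theorem quotient_map_trans {S T : Type*} [TopologicalSpace S] [TopologicalSpace T] {x y z : S}
    (γ : Path.Homotopic.Quotient x y) (δ : Path.Homotopic.Quotient y z) (f : C(S, T)) :
    (γ.trans δ).map f = (γ.map f).trans (δ.map f) := by
  induction γ using Path.Homotopic.Quotient.ind with | mk γ =>
  induction δ using Path.Homotopic.Quotient.ind with | mk δ =>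
  rw [← Path.Homotopic.Quotient.mk_trans, ← Path.Homotopic.Quotient.mk_map, Path.map_trans]
  rfl

theorem quotient_map_symm {S T : Type*} [TopologicalSpace S] [TopologicalSpace T] {x y : S}
    (γ : Path.Homotopic.Quotient x y) (f : C(S, T)) : γ.symm.map f = (γ.map f).symm := by
  induction γ using Path.Homotopic.Quotient.ind with | mk γ => rfl

theorem quotient_symm_cast {S : Type*} [TopologicalSpace S] {x y x' y' : S}
    (γ : Path.Homotopic.Quotient x y) (hx : x' = x) (hy : y' = y) :
    (γ.cast hx hy).symm = γ.symm.cast hy hx := by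
  subst hx hy
  simp

/-- The map of classifying spaces as a continuous map. -/
def IsCoveringMorphism.continuousMap (h : IsCoveringMorphism J I p) :
    C(ClassifyingSpace J, ClassifyingSpace I) :=
  ⟨h.classifyingMap, Realization.continuous_map _ _⟩

theorem IsCoveringMorphism.point_eq (h : IsCoveringMorphism J I p) (hJ : J.IsAdmissible)
    (hI : I.IsAdmissible) (x : W) : hI.point (p.obj x) = h.continuousMap (hJ.point x) :=
  congrArg (Realization.pt I.face) (PathIdeal.Cell.ext_zero rfl)

theorem IsCoveringMorphism.map_arrow (h : IsCoveringMorphism J I p) (hJ : J.IsAdmissible)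
    (hI : I.IsAdmissible) {x y : W} (e : x ⟶ y) :
    hI.arrow (p.map e) = ((hJ.arrow e).map h.continuousMap).cast (h.point_eq hJ hI x)
      (h.point_eq hJ hI y) := by
  have hc : h.cellMap 1 (hJ.isNonzeroPath_arrow e).cell =
      (hI.isNonzeroPath_arrow (p.map e)).cell :=
    PathIdeal.Cell.ext_one rfl rfl (eq_eqToHom_conj _ rfl rfl)
  have h1 := hI.edge_eq_of_cell (hI.isNonzeroPath_arrow (p.map e)) hc (hI.point_eq rfl)
    (hI.point_eq rfl)
  refine h1.trans ?_
  unfold PathIdeal.IsAdmissible.arrow PathIdeal.IsAdmissible.edge FaceAction.edgeClass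
  rw [Path.Homotopic.Quotient.map_cast, Path.Homotopic.Quotient.map_cast]
  rfl

theorem IsCoveringMorphism.map_trans_arrow (h : IsCoveringMorphism J I p) (hJ : J.IsAdmissible)
    (hI : I.IsAdmissible) {x₀ x y : W} (κ : Path.Homotopic.Quotient (hJ.point x₀) (hJ.point x))
    (e : x ⟶ y) :
    ((κ.trans (hJ.arrow e)).map h.continuousMap).cast (h.point_eq hJ hI x₀)
        (h.point_eq hJ hI y) =
      ((κ.map h.continuousMap).cast (h.point_eq hJ hI x₀) (h.point_eq hJ hI x)).trans
        (hI.arrow (p.map e)) := by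
  rw [quotient_map_trans, ← trans_cast_cast _ _ (h.point_eq hJ hI x₀) (h.point_eq hJ hI x)
    (h.point_eq hJ hI y), ← h.map_arrow hJ hI e]

theorem IsCoveringMorphism.map_trans_arrow_symm (h : IsCoveringMorphism J I p)
    (hJ : J.IsAdmissible) (hI : I.IsAdmissible) {x₀ x y : W}
    (κ : Path.Homotopic.Quotient (hJ.point x₀) (hJ.point x)) (e : y ⟶ x) :
    ((κ.trans (hJ.arrow e).symm).map h.continuousMap).cast (h.point_eq hJ hI x₀)
        (h.point_eq hJ hI y) =
      ((κ.map h.continuousMap).cast (h.point_eq hJ hI x₀) (h.point_eq hJ hI x)).trans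
        (hI.arrow (p.map e)).symm := by
  rw [quotient_map_trans, ← trans_cast_cast _ _ (h.point_eq hJ hI x₀) (h.point_eq hJ hI x)
    (h.point_eq hJ hI y), quotient_map_symm, ← quotient_symm_cast, ← h.map_arrow hJ hI e]

/-- The first vertex of a cell lifts because `p` is onto vertices, and then so does the cell. -/
theorem IsCoveringMorphism.surjective_classifyingMap (h : IsCoveringMorphism J I p)
    (hJ : J.IsAdmissible) : Function.Surjective h.classifyingMap := by
  intro x
  obtain ⟨⟨⟨n, c⟩, t⟩, rfl⟩ := Quot.exists_rep x
  obtain ⟨y, hy⟩ := h.surjective (c.1.obj 0).as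
  obtain ⟨c', rfl, -⟩ := h.isCellCovering.exists_lift 0 c (hJ.vertexCell y)
    (PathIdeal.Cell.ext_zero (congrArg I.toHomotopyCat.obj hy))
  exact ⟨Realization.mk J.face c' t, rfl⟩

end Functoriality

/-! ### The cover defined by the fundamental groupoid -/

section FundamentalCover

variable {k : Type w} [Field k] {W V : Type u} [Quiver.{u} W] [Quiver.{u} V]
  {I : PathIdeal k V}

/-- The inverse image of an ideal. -/
noncomputable def PathIdeal.comap (I : PathIdeal k V) (q : W ⥤q V) : PathIdeal k W where
  carrier x y := (I.carrier (q.obj x) (q.obj y)).comap (Finsupp.lmapDomain k k q.mapPath)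
  comp_left_mem {x y z} a ρ hρ := by
    have := I.comp_left_mem (q.mapPath a) hρ
    rw [Submodule.mem_comap]
    simp only [Finsupp.lmapDomain_apply, ← Finsupp.mapDomain_comp] at this ⊢
    convert this using 2
    funext b
    exact q.mapPath_comp a b
  comp_right_mem {x y z} ρ b hρ := by
    have := I.comp_right_mem (q.mapPath b) hρ
    rw [Submodule.mem_comap]
    simp only [Finsupp.lmapDomain_apply, ← Finsupp.mapDomain_comp] at this ⊢
    convert this using 2
    funext a
    exact q.mapPath_comp a b

/-- Morphisms of quivers preserve lengths, so with injectivity the powers of the arrow ideal pull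
back to each other and the same `m` serves. -/
theorem PathIdeal.IsAdmissible.comap (hI : I.IsAdmissible) {q : W ⥤q V}
    (hq : ∀ x y : W, Function.Injective (q.mapPath : Quiver.Path x y → _)) :
    (I.comap q).IsAdmissible := by
  classical
  have hlen : ∀ {x y : W} (a : Quiver.Path x y), (q.mapPath a).length = a.length := by
    intro x y a
    induction a with
    | nil => rfl
    | cons a e ih => simp [ih]
  have hmem : ∀ {m : ℕ} {x y : W} {ρ : Quiver.Path x y →₀ k},
      Finsupp.lmapDomain k k q.mapPath ρ ∈ arrowIdealPow k m (q.obj x) (q.obj y) ↔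
        ρ ∈ arrowIdealPow k m x y := by
    intro m x y ρ
    rw [mem_arrowIdealPow_iff, mem_arrowIdealPow_iff, Finsupp.lmapDomain_apply,
      Finsupp.mapDomain_support_of_injective (hq x y)]
    simp [hlen]
  obtain ⟨m, hm, h⟩ := hI
  exact ⟨m, hm, fun x y => ⟨fun ρ hρ => (h _ _).1 (hmem.2 hρ), fun ρ hρ => hmem.1 ((h _ _).2 hρ)⟩⟩

/-- The classes of paths in the classifying space that are products of classes of edges and
of their inverses. -/
inductive PathIdeal.IsAdmissible.Reach (hI : I.IsAdmissible) (v₀ : V) :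
    ∀ v : V, Path.Homotopic.Quotient (hI.point v₀) (hI.point v) → Prop
  | base : Reach hI v₀ v₀ (Path.Homotopic.Quotient.refl _)
  | step {v v' : V} (e : v ⟶ v') (g : Path.Homotopic.Quotient (hI.point v₀) (hI.point v)) :
    Reach hI v₀ v g → Reach hI v₀ v' (g.trans (hI.arrow e))
  | back {v v' : V} (e : v' ⟶ v) (g : Path.Homotopic.Quotient (hI.point v₀) (hI.point v)) :
    Reach hI v₀ v g → Reach hI v₀ v' (g.trans (hI.arrow e).symm)

/-- The vertices of the cover defined by the fundamental groupoid of the classifying space. -/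
structure FundamentalCover (hI : I.IsAdmissible) (v₀ : V) where
  vertex : V
  cls : Path.Homotopic.Quotient (hI.point v₀) (hI.point vertex)
  reach : hI.Reach v₀ vertex cls

variable {hI : I.IsAdmissible} {v₀ : V}

instance : Quiver.{u} (FundamentalCover hI v₀) where
  Hom a b := {e : a.vertex ⟶ b.vertex // a.cls.trans (hI.arrow e) = b.cls}

variable (hI v₀) in
/-- The projection of the cover. -/
def fundamentalCoverProj : FundamentalCover hI v₀ ⥤q V where
  obj a := a.vertex
  map e := e.1

/-- The class at the far end of an arrow is forced: multiply by the class of the arrow, or by its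
inverse for an entering arrow. -/
theorem fundamentalCoverProj_isCovering : (fundamentalCoverProj hI v₀).IsCovering := by
  refine ⟨fun a => ⟨?_, ?_⟩, fun a => ⟨?_, ?_⟩⟩
  · rintro ⟨⟨v, g, hg⟩, ⟨e, he⟩⟩ ⟨⟨v', g', hg'⟩, ⟨e', he'⟩⟩ h
    change (⟨v, e⟩ : Quiver.Star a.vertex) = ⟨v', e'⟩ at h
    cases h
    obtain rfl : g = g' := he.symm.trans he'
    rfl
  · rintro ⟨v, e⟩
    exact ⟨⟨⟨v, _, .step e _ a.reach⟩, ⟨e, rfl⟩⟩, rfl⟩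
  · rintro ⟨⟨v, g, hg⟩, ⟨e, he⟩⟩ ⟨⟨v', g', hg'⟩, ⟨e', he'⟩⟩ h
    change (⟨v, e⟩ : Quiver.Costar a.vertex) = ⟨v', e'⟩ at h
    cases h
    obtain rfl : g = g' := trans_right_cancel _ (he.trans he'.symm)
    rfl
  · rintro ⟨v, e⟩
    refine ⟨⟨⟨v, _, .back e _ a.reach⟩, ⟨e, ?_⟩⟩, rfl⟩
    exact (Path.Homotopic.Quotient.trans_assoc _ _ _).trans ((congrArg (fun t => a.cls.trans t)
      (Path.Homotopic.Quotient.symm_trans _)).trans (Path.Homotopic.Quotient.trans_refl _))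

theorem FundamentalCover.trans_edgePath {a b : FundamentalCover hI v₀} (γ : Quiver.Path a b) :
    a.cls.trans (hI.edgePath ((fundamentalCoverProj hI v₀).mapPath γ)) = b.cls := by
  induction γ with
  | nil => exact Path.Homotopic.Quotient.trans_refl _
  | cons γ e ih =>
    refine (Path.Homotopic.Quotient.trans_assoc _ _ _).symm.trans ?_
    refine Eq.trans ?_ e.2
    exact congrArg (fun t => t.trans (hI.arrow e.1)) ih

theorem PathIdeal.IsAdmissible.exists_reach (hI : I.IsAdmissible) {x y : Quiver.Symmetrify V}
    (γ : Quiver.Path x y) : ∃ g, hI.Reach (x : V) (y : V) g := by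
  induction γ with
  | nil => exact ⟨_, .base⟩
  | cons γ e ih =>
    obtain ⟨g, hg⟩ := ih
    rcases e with e | e
    · exact ⟨_, .step e g hg⟩
    · exact ⟨_, .back e g hg⟩

/-- A derivation of `Reach` is itself a walk from the base vertex. Keeping only reachable classes
spares a comparison of arbitrary paths with edge paths. -/
theorem FundamentalCover.isConnectedQuiver : IsConnectedQuiver (FundamentalCover hI v₀) := by
  let a₀ : Quiver.Symmetrify (FundamentalCover hI v₀) := (⟨v₀, _, .base⟩ : FundamentalCover hI v₀)
  have h : ∀ (v : V) (g : Path.Homotopic.Quotient (hI.point v₀) (hI.point v))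
      (hg : hI.Reach v₀ v g),
      Nonempty (Quiver.Path a₀ (show Quiver.Symmetrify (FundamentalCover hI v₀) from
        (⟨v, g, hg⟩ : FundamentalCover hI v₀))) := by
    intro v g hg
    induction hg with
    | base => exact ⟨.nil⟩
    | step e g hg ih => exact ⟨ih.some.cons (Sum.inl ⟨e, rfl⟩)⟩
    | back e g hg ih =>
      refine ⟨ih.some.cons (Sum.inr ⟨e, ?_⟩)⟩
      exact (Path.Homotopic.Quotient.trans_assoc _ _ _).trans (by
        rw [Path.Homotopic.Quotient.symm_trans, Path.Homotopic.Quotient.trans_refl])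
  refine ⟨⟨⟨v₀, _, .base⟩⟩, fun a b => ?_⟩
  exact ⟨(Quiver.Path.reverse (h _ _ (FundamentalCover.reach a)).some).comp
    (h _ _ (FundamentalCover.reach b)).some⟩

theorem fundamentalCover_isCover (hV : IsConnectedQuiver V) :
    IsCover (I.comap (fundamentalCoverProj hI v₀)) I (fundamentalCoverProj hI v₀) := by
  classical
  have hcov := fundamentalCoverProj_isCovering (hI := hI) (v₀ := v₀)
  have hinj : ∀ x y : FundamentalCover hI v₀,
      Function.Injective ((fundamentalCoverProj hI v₀).mapPath : Quiver.Path x y → _) := by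
    intro x y a b hab
    have := pathStar_ext hcov a b (by rw [hab])
    simpa using this
  refine ⟨hI.comap hinj, FundamentalCover.isConnectedQuiver, fun ρ hρ => hρ, fun v => ?_, hcov,
    fun x y ρ hρ => ?_⟩
  · obtain ⟨g, hg⟩ := hI.exists_reach (hV.2 v₀ v).some
    exact ⟨⟨v, g, hg⟩, rfl⟩
  · have hsame : ∀ a ∈ ρ.support, ∀ b ∈ ρ.support, hI.edgePath a = hI.edgePath b := by
      intro a ha b hb
      by_cases hab : a = b
      · rw [hab]
      · exact hI.edgePath_eq_of_isMinimalRelation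
          ⟨hρ, Finset.one_lt_card.2 ⟨a, ha, b, hb, hab⟩⟩ ha hb
    obtain ⟨b₀, hb₀⟩ := Finsupp.support_nonempty_iff.2 hρ.ne_zero
    obtain ⟨y, rfl, a₀, rfl⟩ := exists_lift_path_of_star hcov b₀
    -- All paths of the relation have the same class, so their lifts from `x` end with the same
    -- class over the same vertex, that is, all at `y`. The relation therefore lifts term by term.
    have hrange : (ρ.support : Set (Quiver.Path _ _)) ⊆
        Set.range ((fundamentalCoverProj hI v₀).mapPath : Quiver.Path x y → _) := by
      intro b hb
      obtain ⟨y', hy', a, ha⟩ := exists_lift_path_of_star hcov b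
      have hcls : ∀ (z : FundamentalCover hI v₀) (hz : z.vertex = y.vertex)
          (a : Quiver.Path x z) (b : Quiver.Path x.vertex y.vertex),
          hz ▸ (fundamentalCoverProj hI v₀).mapPath a = b → hI.edgePath b = hI.edgePath
            ((fundamentalCoverProj hI v₀).mapPath a₀) → z = y := by
        rintro ⟨z, g, hg⟩ hz a b hab hb
        obtain ⟨y, g', hg'⟩ := y
        dsimp only at hz
        subst hz
        have h1 := FundamentalCover.trans_edgePath a
        have h2 := FundamentalCover.trans_edgePath a₀
        obtain rfl : g = g' := h1.symm.trans
          ((congrArg (fun t => x.cls.trans (hI.edgePath t)) hab).trans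
            ((congrArg (fun t => x.cls.trans t) hb).trans h2))
        rfl
      obtain rfl := hcls y' hy' a b ha (hsame _ hb _ hb₀)
      exact ⟨a, ha⟩
    refine ⟨y, rfl, ρ.comapDomain _ (hinj x y).injOn, ?_, ?_⟩
    · refine Submodule.mem_comap.2 ?_
      rw [Finsupp.lmapDomain_apply, Finsupp.mapDomain_comapDomain _ (hinj x y) _ hrange]
      exact hρ.mem
    · exact Finsupp.mapDomain_comapDomain _ (hinj x y) _ hrange

end FundamentalCover

/-! ### Universal covers -/

section Universal

variable {k : Type w} [Field k] {W V : Type u} [Quiver.{u} W] [Quiver.{u} V]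
  {J : PathIdeal k W} {I : PathIdeal k V} {hI : I.IsAdmissible} {v₀ : V}

/-- The source of a connected covering morphism that factors through the fundamental cover has a
simply connected classifying space. -/
theorem simplyConnectedSpace_of_factor (hJ : J.IsAdmissible) (hW : IsConnectedQuiver W)
    (π : W ⥤q FundamentalCover hI v₀)
    (h : IsCoveringMorphism J I (π ⋙q fundamentalCoverProj hI v₀)) :
    SimplyConnectedSpace (ClassifyingSpace J) := by
  obtain ⟨⟨x₀⟩, hconn⟩ := hW
  have he := h.point_eq hJ hI
  -- The invariant kept along walks: the image of `κ` takes the class recorded at `π x₀` to the one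
  -- recorded at `π x`.
  have hstep : ∀ {x y : W} (κ : Path.Homotopic.Quotient (hJ.point x₀) (hJ.point x)),
      (π.obj x₀).cls.trans ((κ.map h.continuousMap).cast (he x₀) (he x)) = (π.obj x).cls →
      ∀ e : x ⟶ y, (π.obj x₀).cls.trans
        (((κ.trans (hJ.arrow e)).map h.continuousMap).cast (he x₀) (he y)) = (π.obj y).cls := by
    intro x y κ hκ e
    refine (congrArg (fun t => (π.obj x₀).cls.trans t) (h.map_trans_arrow hJ hI κ e)).trans ?_
    refine (Path.Homotopic.Quotient.trans_assoc _ _ _).symm.trans ?_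
    exact (congrArg (fun t => t.trans (hI.arrow (π.map e).1)) hκ).trans (π.map e).2
  have key : ∀ {x : Quiver.Symmetrify W} (_ : Quiver.Path (V := Quiver.Symmetrify W) x₀ x),
      ∃ κ : Path.Homotopic.Quotient (hJ.point x₀) (hJ.point (x : W)),
        (π.obj x₀).cls.trans ((κ.map h.continuousMap).cast (he x₀) (he x)) =
          (π.obj (x : W)).cls := by
    intro x γ
    induction γ with
    | nil =>
      refine ⟨Path.Homotopic.Quotient.refl _, ?_⟩
      have : ((Path.Homotopic.Quotient.refl (hJ.point x₀)).map h.continuousMap).cast (he x₀)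
          (he x₀) = Path.Homotopic.Quotient.refl _ := by
        have : ∀ {a b : ClassifyingSpace I} (hab : a = b),
            (Path.Homotopic.Quotient.refl b).cast hab hab = Path.Homotopic.Quotient.refl a := by
          rintro a _ rfl
          simp
        exact this (he x₀)
      exact (congrArg _ this).trans (Path.Homotopic.Quotient.trans_refl _)
    | @cons x y γ e ih =>
      obtain ⟨κ, hκ⟩ := ih
      rcases e with e | e
      · exact ⟨κ.trans (hJ.arrow e), hstep κ hκ e⟩
      · refine ⟨κ.trans (hJ.arrow e).symm, ?_⟩
        refine (congrArg (fun t => (π.obj x₀).cls.trans t)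
          (h.map_trans_arrow_symm hJ hI κ e)).trans ?_
        refine (Path.Homotopic.Quotient.trans_assoc _ _ _).symm.trans ?_
        refine (congrArg (fun t => t.trans (hI.arrow (π.map e).1).symm)
          (hκ.trans (π.map e).2.symm)).trans ?_
        exact (Path.Homotopic.Quotient.trans_assoc _ _ _).trans
          ((congrArg (fun t => (π.obj _).cls.trans t)
            (Path.Homotopic.Quotient.trans_symm _)).trans (Path.Homotopic.Quotient.trans_refl _))
  -- The walks are arbitrary; the invariant already fixes the images of their classes.
  choose κ hκ using fun x : W => key (hconn x₀ x).some
  refine hJ.simplyConnectedSpace κ fun {x y} e => ?_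
  -- Homotopies lift along a covering map, so classes with common endpoints may be compared
  -- downstairs.
  refine h.isCoveringMap_classifyingMap.injective_path_homotopic_map _ _ ?_
  change ((κ x).trans (hJ.arrow e)).map h.continuousMap = (κ y).map h.continuousMap
  have h1 : (((κ x).trans (hJ.arrow e)).map h.continuousMap).cast (he x₀) (he y) =
      ((κ y).map h.continuousMap).cast (he x₀) (he y) :=
    trans_left_cancel (π.obj x₀).cls ((hstep _ (hκ x) e).trans (hκ y).symm)
  have h2 := congrArg (fun t => t.cast (he x₀).symm (he y).symm) h1
  simpa using h2

end Universal

end BoundQuiver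

theorem corollary4p4 {k : Type w} [Field k]
    {V : Type u} [Quiver.{u} V] [Finite V] [∀ x y : V, Finite (x ⟶ y)]
    (hV : BoundQuiver.IsConnectedQuiver V)
    (I : BoundQuiver.PathIdeal k V) (hI : I.IsAdmissible)
    {W : Type u} [Quiver.{u} W] (J : BoundQuiver.PathIdeal k W) (p : W ⥤q V)
    (hp : BoundQuiver.IsUniversalCover J I p) :
    BoundQuiver.IsUniversalCoveringSpace hp.isCover.isCoveringMorphism.classifyingMap := by
  have h := hp.isCover.isCoveringMorphism
  refine ⟨h.isCoveringMap_classifyingMap, h.surjective_classifyingMap hp.isCover.admissible, ?_⟩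
  obtain ⟨v₀⟩ := hV.1
  -- The fundamental cover lies in the universe `u` of the quiver, so the universal property applies
  -- to it.
  obtain ⟨π, -, rfl⟩ := hp.universal _ _ _
    (BoundQuiver.fundamentalCover_isCover (hI := hI) (v₀ := v₀) hV)
  exact BoundQuiver.simplyConnectedSpace_of_factor hp.isCover.admissible hp.isCover.connected π h
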